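/- Let $N\ge 1$ be an integer, let $s\in(0,1)$ with $N>2s$, and put $2^*_s:=\frac{2N}{N-2s}$. Let $$\dot H^s(\mathbb R^N):=\Big\{u\in L^{2^*_s}(\mathbb R^N)\;:\;\iint_{\mathbb R^{2N}}\frac{|u(x)-u(y)|^2}{|x-y|^{N+2s}}\,dx\,dy<\infty\Big\},\qquad \|u\|_{\dot H^s}:=\Big(\iint_{\mathbb R^{2N}}\frac{|u(x)-u(y)|^2}{|x-y|^{N+2s}}\,dx\,dy\Big)^{1/2},$$ let $(\dot H^s)'$ be its dual space with the dual norm, and write $\langle f,u\rangle$ for the duality bracket and $u_+:=\max\{u,0\}$. Let $a\in L^\infty(\mathbb R^N)$ with $a>0$ a.e. For $f\in(\dot H^s)'$, a positive weak solution of $$(-\Delta)^su=a(x)|u|^{2^*_s-2}u+f\quad\text{in }\mathbb R^N,\qquad u\in\dot H^s(\mathbb R^N),\tag{E}$$ is a function $u\in\dot H^s(\mathbb R^N)$ with $u>0$ a.e. in $\mathbb R^N$ such that for every $\phi\in\dot H^s(\mathbb R^N)$ $$\iint_{\mathbb R^{2N}}\frac{(u(x)-u(y))(\phi(x)-\phi(y))}{|x-y|^{N+2s}}\,dx\,dy=\int_{\mathbb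 R^N}a(x)\,u^{2^*_s-1}\phi\,dx+\langle f,\phi\rangle .$$ Its energy is $\bar I_{a,f}(u):=\frac12\|u\|_{\dot H^s}^2-\frac1{2^*_s}\int_{\mathbb R^N}a|u|^{2^*_s}\,dx-\langle f,u\rangle$, and the truncated functional is $I_{a,f}(u):=\frac12\|u\|_{\dot H^s}^2-\frac1{2^*_s}\int_{\mathbb R^N}a\,u_+^{2^*_s}\,dx-\langle f,u\rangle$ for $u\in\dot H^s(\mathbb R^N)$. Then there are $d>0$ and $r>0$ (depending on $N$, $s$, $a$, but not on $f$) such that for every $f\in(\dot H^s)'$ with $f\neq0$, with $\langle f,u\rangle\ge0$ whenever $u\in\dot H^s(\mathbb R^N)$ and $u\ge0$ a.e., and with $\|f\|_{(\dot H^s)'}\le d$: the functional $I_{a,f}$ is strictly convex on the open ball $B_r:=\{u\in\dot H^s(\mathbb R^N):\|u\|_{\dot H^s}<r\}$, and equation (E) has a positive weak solution $u\in B_r$ with $\bar I_{a,f}(u)<0$ and $I_{a,f}(u)=\min_{B_r}I_{a,f}$. -/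

import Mathlib

open MeasureTheory

noncomputable section

/-- The critical exponent `2N / (N - 2s)`. -/
def critExp (N : ℕ) (s : ℝ) : ℝ := 2 * N / (N - 2 * s)

/-- The integrand `(u(x) - u(y)) (v(x) - v(y)) / |x - y| ^ (N + 2s)` at the point `z = (x, y)`. -/
def gagliardoIntegrand {N : ℕ} (s : ℝ) (u v : EuclideanSpace ℝ (Fin N) → ℝ)
    (z : EuclideanSpace ℝ (Fin N) × EuclideanSpace ℝ (Fin N)) : ℝ :=
  (u z.1 - u z.2) * (v z.1 - v z.2) / ‖z.1 - z.2‖ ^ ((N : ℝ) + 2 * s)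

/-- The Gagliardo form
`∬ (u(x) - u(y)) (v(x) - v(y)) / |x - y| ^ (N + 2s) dx dy`. -/
def gagliardoForm {N : ℕ} (s : ℝ) (u v : EuclideanSpace ℝ (Fin N) → ℝ) : ℝ :=
  ∫ z, gagliardoIntegrand s u v z

theorem aestronglyMeasurable_gagliardoIntegrand {N : ℕ} (s : ℝ)
    {u v : EuclideanSpace ℝ (Fin N) → ℝ}
    (hu : AEStronglyMeasurable u volume) (hv : AEStronglyMeasurable v volume) :
    AEStronglyMeasurable (gagliardoIntegrand s u v) volume := by
  have hk : Measurable (fun z : EuclideanSpace ℝ (Fin N) × EuclideanSpace ℝ (Fin N) =>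
      ‖z.1 - z.2‖ ^ ((N : ℝ) + 2 * s)) := by fun_prop
  have h1 : AEMeasurable (fun z : EuclideanSpace ℝ (Fin N) × EuclideanSpace ℝ (Fin N) =>
      u z.1 - u z.2) volume := (hu.comp_fst.sub hu.comp_snd).aemeasurable
  have h2 : AEMeasurable (fun z : EuclideanSpace ℝ (Fin N) × EuclideanSpace ℝ (Fin N) =>
      v z.1 - v z.2) volume := (hv.comp_fst.sub hv.comp_snd).aemeasurable
  exact ((h1.mul h2).div hk.aemeasurable).aestronglyMeasurable

/-- Two functions of finite Gagliardo energy have an integrable product integrand. -/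
theorem integrable_gagliardoIntegrand {N : ℕ} {s : ℝ} {u v : EuclideanSpace ℝ (Fin N) → ℝ}
    (hu : AEStronglyMeasurable u volume) (hv : AEStronglyMeasurable v volume)
    (hu' : Integrable (gagliardoIntegrand s u u) volume)
    (hv' : Integrable (gagliardoIntegrand s v v) volume) :
    Integrable (gagliardoIntegrand s u v) volume := by
  refine (hu'.add hv').mono' (aestronglyMeasurable_gagliardoIntegrand s hu hv)
    (Filter.Eventually.of_forall fun z => ?_)
  have hk : 0 ≤ ‖z.1 - z.2‖ ^ ((N : ℝ) + 2 * s) := by positivity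
  simp only [gagliardoIntegrand, Pi.add_apply, ← add_div]
  rw [Real.norm_eq_abs, abs_div, abs_of_nonneg hk]
  refine div_le_div_of_nonneg_right ?_ hk
  rw [abs_le]
  constructor <;>
    nlinarith [sq_nonneg (u z.1 - u z.2 + (v z.1 - v z.2)),
      sq_nonneg (u z.1 - u z.2 - (v z.1 - v z.2)), sq_nonneg (u z.1 - u z.2),
      sq_nonneg (v z.1 - v z.2)]

theorem gagliardoIntegrand_congr {N : ℕ} (s : ℝ) {u u' v v' : EuclideanSpace ℝ (Fin N) → ℝ}
    (hu : u =ᵐ[volume] u') (hv : v =ᵐ[volume] v') :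
    gagliardoIntegrand s u v =ᵐ[volume] gagliardoIntegrand s u' v' := by
  have hf := Measure.quasiMeasurePreserving_fst
    (μ := (volume : Measure (EuclideanSpace ℝ (Fin N))))
    (ν := (volume : Measure (EuclideanSpace ℝ (Fin N))))
  have hs := Measure.quasiMeasurePreserving_snd
    (μ := (volume : Measure (EuclideanSpace ℝ (Fin N))))
    (ν := (volume : Measure (EuclideanSpace ℝ (Fin N))))
  filter_upwards [hf.ae hu, hs.ae hu, hf.ae hv, hs.ae hv] with z h1 h2 h3 h4
  simp only [gagliardoIntegrand, h1, h2, h3, h4]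

theorem gagliardoIntegrand_comm {N : ℕ} (s : ℝ) (u v : EuclideanSpace ℝ (Fin N) → ℝ) :
    gagliardoIntegrand s u v = gagliardoIntegrand s v u := by
  funext z
  simp only [gagliardoIntegrand, mul_comm]

theorem gagliardoIntegrand_add_left {N : ℕ} (s : ℝ) (u u' v : EuclideanSpace ℝ (Fin N) → ℝ) :
    gagliardoIntegrand s (u + u') v = gagliardoIntegrand s u v + gagliardoIntegrand s u' v := by
  funext z
  simp only [gagliardoIntegrand, Pi.add_apply]
  ring

theorem gagliardoIntegrand_smul_left {N : ℕ} (s c : ℝ) (u v : EuclideanSpace ℝ (Fin N) → ℝ) :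
    gagliardoIntegrand s (c • u) v = c • gagliardoIntegrand s u v := by
  funext z
  simp only [gagliardoIntegrand, Pi.smul_apply, smul_eq_mul]
  ring

theorem gagliardoIntegrand_self_nonneg {N : ℕ} (s : ℝ) (u : EuclideanSpace ℝ (Fin N) → ℝ)
    (z : EuclideanSpace ℝ (Fin N) × EuclideanSpace ℝ (Fin N)) :
    0 ≤ gagliardoIntegrand s u u z :=
  div_nonneg (mul_self_nonneg _) (by positivity)

/-- The elements `u` of `L ^ (2N / (N - 2s))` with
`∬ |u(x) - u(y)| ^ 2 / |x - y| ^ (N + 2s) dx dy < ∞`, as a linear subspace. -/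
def homSobolevSubmodule (N : ℕ) (s : ℝ) :
    Submodule ℝ (Lp (α := EuclideanSpace ℝ (Fin N)) ℝ (ENNReal.ofReal (critExp N s)) volume) where
  carrier := {u | Integrable (gagliardoIntegrand s u u) volume}
  zero_mem' := by
    have h0 := Lp.coeFn_zero (α := EuclideanSpace ℝ (Fin N)) ℝ
      (ENNReal.ofReal (critExp N s)) volume
    refine Integrable.congr ?_ (gagliardoIntegrand_congr s h0 h0).symm
    have : gagliardoIntegrand (N := N) s 0 0 = 0 := by
      funext z; simp [gagliardoIntegrand]
    rw [this]
    exact integrable_zero _ _ _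
  add_mem' := by
    intro u v hu hv
    have hum := Lp.aestronglyMeasurable u
    have hvm := Lp.aestronglyMeasurable v
    have h := Lp.coeFn_add u v
    refine Integrable.congr ?_ (gagliardoIntegrand_congr s h h).symm
    rw [gagliardoIntegrand_add_left, gagliardoIntegrand_comm s (u : _ → ℝ) (_ + _),
      gagliardoIntegrand_comm s (v : _ → ℝ) (_ + _), gagliardoIntegrand_add_left,
      gagliardoIntegrand_add_left]
    exact (Integrable.add hu (integrable_gagliardoIntegrand hvm hum hv hu)).add
      ((integrable_gagliardoIntegrand hum hvm hu hv).add hv)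
  smul_mem' := by
    intro c u hu
    have h := Lp.coeFn_smul c u
    refine Integrable.congr ?_ (gagliardoIntegrand_congr s h h).symm
    rw [gagliardoIntegrand_smul_left, gagliardoIntegrand_comm, gagliardoIntegrand_smul_left]
    exact (Integrable.smul c hu).smul c

/-- The homogeneous fractional Sobolev space on `ℝ ^ N`. It is a type synonym, so that it carries
the Gagliardo norm below and not the norm of the Lebesgue space. -/
def HomSobolev (N : ℕ) (s : ℝ) : Type := ↥(homSobolevSubmodule N s)

namespace HomSobolev

variable {N : ℕ} {s : ℝ}

instance : AddCommGroup (HomSobolev N s) := inferInstanceAs (AddCommGroup (homSobolevSubmodule N s))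

instance : Module ℝ (HomSobolev N s) := inferInstanceAs (Module ℝ (homSobolevSubmodule N s))

/-- The underlying element of the Lebesgue space. -/
def toLp (u : HomSobolev N s) :
    Lp (α := EuclideanSpace ℝ (Fin N)) ℝ (ENNReal.ofReal (critExp N s)) volume :=
  Subtype.val u

instance : CoeFun (HomSobolev N s) (fun _ => EuclideanSpace ℝ (Fin N) → ℝ) :=
  ⟨fun u => (toLp u : EuclideanSpace ℝ (Fin N) → ℝ)⟩

theorem aestronglyMeasurable (u : HomSobolev N s) : AEStronglyMeasurable u volume :=
  Lp.aestronglyMeasurable (toLp u)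

theorem integrable_self (u : HomSobolev N s) : Integrable (gagliardoIntegrand s u u) volume :=
  u.2

theorem integrable_pair (u v : HomSobolev N s) :
    Integrable (gagliardoIntegrand s u v) volume :=
  integrable_gagliardoIntegrand u.aestronglyMeasurable v.aestronglyMeasurable
    u.integrable_self v.integrable_self

theorem coeFn_add (u v : HomSobolev N s) : ⇑(toLp (u + v)) =ᵐ[volume] (u : _ → ℝ) + (v : _ → ℝ) :=
  Lp.coeFn_add (toLp u) (toLp v)

theorem coeFn_smul (c : ℝ) (u : HomSobolev N s) : ⇑(toLp (c • u)) =ᵐ[volume] c • (u : _ → ℝ) :=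
  Lp.coeFn_smul c (toLp u)

/-- A function of the space with vanishing Gagliardo energy is constant, hence zero. -/
theorem eq_zero_of_gagliardoForm_eq_zero [hs : Fact (0 < s)] [hN : Fact (2 * s < N)]
    (u : HomSobolev N s) (h : gagliardoForm s u u = 0) : u = 0 := by
  have hs0 := hs.out
  have hN0 := hN.out
  have hNpos : 0 < (N : ℝ) := by linarith
  have hNn : 0 < N := by exact_mod_cast hNpos
  have : Nonempty (Fin N) := ⟨⟨0, hNn⟩⟩
  have hp : 0 < critExp N s := by
    unfold critExp
    apply div_pos <;> linarith
  have hz : gagliardoIntegrand s u u =ᵐ[volume] 0 :=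
    (integral_eq_zero_iff_of_nonneg (gagliardoIntegrand_self_nonneg s _) u.integrable_self).1 h
  have hz' : ∀ᵐ z : EuclideanSpace ℝ (Fin N) × EuclideanSpace ℝ (Fin N)
      ∂((volume : Measure (EuclideanSpace ℝ (Fin N))).prod volume), u z.1 = u z.2 := by
    filter_upwards [hz] with z hz
    by_cases hxy : z.1 = z.2
    · rw [hxy]
    have hk : ‖z.1 - z.2‖ ^ ((N : ℝ) + 2 * s) ≠ 0 :=
      (Real.rpow_pos_of_pos (norm_pos_iff.2 (sub_ne_zero.2 hxy)) _).ne'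
    simp only [gagliardoIntegrand, Pi.zero_apply, div_eq_zero_iff, hk, or_false,
      mul_self_eq_zero] at hz
    linarith
  obtain ⟨x, hx⟩ := (Measure.ae_ae_of_ae_prod hz').exists
  have hc : (u : _ → ℝ) =ᵐ[volume] fun _ => u x := by
    filter_upwards [hx] with y hy using hy.symm
  have hm : MemLp (fun _ : EuclideanSpace ℝ (Fin N) => u x) (ENNReal.ofReal (critExp N s)) volume :=
    (Lp.memLp (toLp u)).ae_eq hc
  have hux : u x = 0 := by
    rcases (memLp_const_iff (by simpa using hp) ENNReal.ofReal_ne_top).1 hm with h0 | h0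
    · exact h0
    · simp at h0
  have : toLp u = 0 := by
    rw [Lp.eq_zero_iff_ae_eq_zero]
    filter_upwards [hc] with y hy
    rw [hy, hux, Pi.zero_apply]
  exact Subtype.ext this

/-- The inner product `∬ (u(x) - u(y)) (v(x) - v(y)) / |x - y| ^ (N + 2s) dx dy`. -/
@[reducible] def core [Fact (0 < s)] [Fact (2 * s < N)] : InnerProductSpace.Core ℝ (HomSobolev N s) where
  inner u v := gagliardoForm s u v
  conj_inner_symm u v := by
    simp only [conj_trivial, gagliardoForm, gagliardoIntegrand_comm s (u : _ → ℝ)]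
  re_inner_nonneg u := integral_nonneg (gagliardoIntegrand_self_nonneg s _)
  add_left u v w := by
    simp only [gagliardoForm]
    rw [integral_congr_ae (gagliardoIntegrand_congr s (coeFn_add u v) (Filter.EventuallyEq.refl _ _)),
      gagliardoIntegrand_add_left]
    exact integral_add (integrable_pair u w) (integrable_pair v w)
  smul_left u v c := by
    simp only [gagliardoForm, conj_trivial]
    rw [integral_congr_ae (gagliardoIntegrand_congr s (coeFn_smul c u) (Filter.EventuallyEq.refl _ _)),
      gagliardoIntegrand_smul_left]
    exact integral_const_mul c _
  definite u h := eq_zero_of_gagliardoForm_eq_zero u h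

instance [Fact (0 < s)] [Fact (2 * s < N)] : NormedAddCommGroup (HomSobolev N s) :=
  core.toNormedAddCommGroup

instance [Fact (0 < s)] [Fact (2 * s < N)] : InnerProductSpace ℝ (HomSobolev N s) :=
  InnerProductSpace.ofCore core.toCore

theorem inner_eq [Fact (0 < s)] [Fact (2 * s < N)] (u v : HomSobolev N s) :
    inner ℝ u v = gagliardoForm s u v := rfl

theorem norm_eq [Fact (0 < s)] [Fact (2 * s < N)] (u : HomSobolev N s) :
    ‖u‖ = Real.sqrt (∫ z : EuclideanSpace ℝ (Fin N) × EuclideanSpace ℝ (Fin N),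
      |u z.1 - u z.2| ^ 2 / ‖z.1 - z.2‖ ^ ((N : ℝ) + 2 * s)) := by
  rw [norm_eq_sqrt_real_inner, inner_eq]
  simp only [gagliardoForm, gagliardoIntegrand, pow_two, abs_mul_abs_self]

end HomSobolev

/-- A nontrivial nonnegative functional in the dual of the homogeneous Sobolev space. -/
def IsNonnegNontrivial {N : ℕ} {s : ℝ} [Fact (0 < s)] [Fact (2 * s < N)]
    (f : StrongDual ℝ (HomSobolev N s)) : Prop :=
  f ≠ 0 ∧ ∀ u : HomSobolev N s, (∀ᵐ x, 0 ≤ u x) → 0 ≤ f u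

/-- Positive weak solutions of `(-Δ)^s u = a |u| ^ (2N / (N - 2s) - 2) u + f` in `ℝ ^ N`. -/
def IsPositiveWeakSolution {N : ℕ} {s : ℝ} [Fact (0 < s)] [Fact (2 * s < N)]
    (a : EuclideanSpace ℝ (Fin N) → ℝ) (f : StrongDual ℝ (HomSobolev N s))
    (u : HomSobolev N s) : Prop :=
  (∀ᵐ x, 0 < u x) ∧
    ∀ φ : HomSobolev N s,
      gagliardoForm s u φ = (∫ x, a x * (u x) ^ (critExp N s - 1) * φ x) + f φ

/-- The energy
`‖u‖ ^ 2 / 2 - (1 / p) ∫ a |u| ^ p dx - ⟨f, u⟩` with `p = 2N / (N - 2s)`. -/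
def energy {N : ℕ} {s : ℝ} [Fact (0 < s)] [Fact (2 * s < N)]
    (a : EuclideanSpace ℝ (Fin N) → ℝ) (f : StrongDual ℝ (HomSobolev N s))
    (u : HomSobolev N s) : ℝ :=
  1 / 2 * ‖u‖ ^ 2 - 1 / critExp N s * (∫ x, a x * |u x| ^ critExp N s) - f u

/-- The truncated energy
`‖u‖ ^ 2 / 2 - (1 / p) ∫ a (u_+) ^ p dx - ⟨f, u⟩` with `p = 2N / (N - 2s)`. -/
def truncatedEnergy {N : ℕ} {s : ℝ} [Fact (0 < s)] [Fact (2 * s < N)]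
    (a : EuclideanSpace ℝ (Fin N) → ℝ) (f : StrongDual ℝ (HomSobolev N s))
    (u : HomSobolev N s) : ℝ :=
  1 / 2 * ‖u‖ ^ 2 - 1 / critExp N s * (∫ x, a x * (max (u x) 0) ^ critExp N s) - f u

end

noncomputable section

/-! With p the critical exponent, the Sobolev inequality bounds `∫ a u_+^p` by a multiple of
`‖u‖^p`, and p > 2. Near the origin the quadratic part of the truncated energy therefore dominates,
also at second order: the convexity defect of the nonlinear term on a ball of radius r is of size
`r^(p-2) ‖u - v‖²`. Hence for small r the truncated energy is strongly convex on the closed ball,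
whatever f is, because f enters linearly (`exists_strongConvexOn`).

A strongly convex continuous function bounded below has Cauchy minimising sequences, so completeness
of the space gives a minimiser with no weak compactness. Smallness of f makes the energy positive on
the sphere, while moving slightly in a direction where f is positive makes it negative inside; the
minimiser is thus interior, nonzero and of negative energy, and it satisfies the Euler-Lagrange
equation (`euler_lagrange`).

The right-hand side of that equation is nonnegative on nonnegative test functions. Testing with the
negative part gives u ≥ 0, and a nonlocal strong maximum principle (`ae_pos_of_supersolution`) gives
u > 0, so truncation is invisible. The Sobolev inequality and completeness are proved here from
scratch, by a pointwise averaging argument and by Fatou's lemma. -/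

/-! ### The critical exponent and the fractional Sobolev inequality. -/

theorem two_lt_critExp {N : ℕ} {s : ℝ} (hs : 0 < s) (hN : 2 * s < N) : 2 < critExp N s := by
  unfold critExp
  rw [lt_div_iff₀ (by linarith)]
  linarith

/-- The scaling relation that makes the powers of `|u x|` match in `rpow_le_mul_integral`. -/
theorem critExp_mul_eq {N : ℕ} {s : ℝ} (hs : 0 < s) (hN : 2 * s < N) :
    critExp N s * (2 * s / N) = critExp N s - 2 := by
  have h1 : (0 : ℝ) < N := by linarith
  have h2 : (N : ℝ) - 2 * s ≠ 0 := by linarith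
  unfold critExp
  field_simp
  ring

theorem two_mul_div_eq_one_sub {N : ℕ} {s : ℝ} (hs : 0 < s) (hN : 2 * s < N) :
    2 * s / N = 1 - 2 / critExp N s := by
  have h1 := two_lt_critExp hs hN
  have h2 := critExp_mul_eq hs hN
  field_simp at h2 ⊢
  linarith

/-- Split at the level l: above it, `|t|^(2-p) ≤ l^(2-p)` since the exponent is nonpositive. This
controls a local L² average by the L^p integral. -/
theorem sq_le_sq_add_rpow_mul_rpow {p l t : ℝ} (hp : 2 ≤ p) (hl : 0 < l) :
    t ^ 2 ≤ l ^ 2 + l ^ (2 - p) * |t| ^ p := by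
  rcases le_or_gt |t| l with h | h
  · have : t ^ 2 ≤ l ^ 2 := by rw [← sq_abs t]; gcongr
    have h2 : 0 ≤ l ^ (2 - p) * |t| ^ p := by positivity
    linarith
  · have ht : 0 < |t| := hl.trans h
    have h3 : t ^ 2 = |t| ^ (2 - p) * |t| ^ p := by
      rw [← Real.rpow_add ht, ← sq_abs t]
      norm_num
    have h4 : |t| ^ (2 - p) ≤ l ^ (2 - p) :=
      Real.rpow_le_rpow_of_nonpos hl h.le (by linarith)
    have h5 : |t| ^ (2 - p) * |t| ^ p ≤ l ^ (2 - p) * |t| ^ p := by gcongr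
    nlinarith [sq_nonneg l]

/-- Averaging `u(x)² ≤ 2 (u(x) - u(y))² + 2 u(y)²` over a ball around `x`. -/
theorem volume_ball_mul_sq_le {N : ℕ} {s p r l : ℝ} (hs : 0 < s) (hp : 2 ≤ p) (hr : 0 < r)
    (hl : 0 < l) {u : EuclideanSpace ℝ (Fin N) → ℝ} {x : EuclideanSpace ℝ (Fin N)}
    (hg : Integrable (fun y => gagliardoIntegrand s u u (x, y)))
    (hu : Integrable (fun y => |u y| ^ p)) :
    volume.real (Metric.ball x r) * u x ^ 2 ≤
      2 * r ^ ((N : ℝ) + 2 * s) * (∫ y, gagliardoIntegrand s u u (x, y)) +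
        2 * (l ^ 2 * volume.real (Metric.ball x r) + l ^ (2 - p) * ∫ y, |u y| ^ p) := by
  set B := Metric.ball x r with hB
  have hBm : MeasurableSet B := measurableSet_ball
  have hfin : volume B ≠ ⊤ := measure_ball_lt_top.ne
  set F : EuclideanSpace ℝ (Fin N) → ℝ := fun y =>
    2 * r ^ ((N : ℝ) + 2 * s) * gagliardoIntegrand s u u (x, y) +
      2 * l ^ (2 - p) * |u y| ^ p with hF
  have hFi : Integrable F := (hg.const_mul _).add (hu.const_mul _)
  have hF0 : ∀ y, 0 ≤ F y := fun y => by
    have := gagliardoIntegrand_self_nonneg s u (x, y)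
    positivity
  have hpt : ∀ y ∈ B, u x ^ 2 ≤ F y + 2 * l ^ 2 := by
    intro y hy
    have h1 := sq_le_sq_add_rpow_mul_rpow (t := u y) hp hl
    have h2 : (u x - u y) ^ 2 ≤
        r ^ ((N : ℝ) + 2 * s) * gagliardoIntegrand s u u (x, y) := by
      by_cases hxy : x = y
      · subst hxy; simp [gagliardoIntegrand]
      have hd : 0 < ‖x - y‖ := norm_pos_iff.2 (sub_ne_zero.2 hxy)
      have hd' : ‖x - y‖ ≤ r := by
        rw [hB, Metric.mem_ball, dist_comm, dist_eq_norm] at hy; exact hy.le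
      have hk : ‖x - y‖ ^ ((N : ℝ) + 2 * s) ≤ r ^ ((N : ℝ) + 2 * s) := by gcongr
      have hk0 : 0 < ‖x - y‖ ^ ((N : ℝ) + 2 * s) := by positivity
      simp only [gagliardoIntegrand]
      rw [mul_div_assoc', le_div_iff₀ hk0]
      nlinarith [sq_nonneg (u x - u y)]
    have h3 : u x ^ 2 ≤ 2 * (u x - u y) ^ 2 + 2 * u y ^ 2 := by
      nlinarith [sq_nonneg (u x - 2 * u y)]
    simp only [hF]
    nlinarith
  have hint : ∫ _ in B, u x ^ 2 ≤ ∫ y in B, (F y + 2 * l ^ 2) := by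
    refine setIntegral_mono_on ?_ ?_ hBm hpt
    · exact integrableOn_const hfin
    · exact hFi.integrableOn.add (integrableOn_const hfin)
  rw [integral_add hFi.integrableOn (integrableOn_const hfin), setIntegral_const,
    setIntegral_const] at hint
  have h4 : ∫ y in B, F y ≤ ∫ y, F y :=
    setIntegral_le_integral hFi (Filter.Eventually.of_forall hF0)
  have h5 : ∫ y, F y = 2 * r ^ ((N : ℝ) + 2 * s) * (∫ y, gagliardoIntegrand s u u (x, y)) +
      2 * l ^ (2 - p) * ∫ y, |u y| ^ p := by
    simp only [hF]
    rw [integral_add (hg.const_mul _) (hu.const_mul _), integral_const_mul, integral_const_mul]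
  simp only [smul_eq_mul] at hint
  linarith

namespace HomSobolev

variable {N : ℕ} {s : ℝ} [hs : Fact (0 < s)] [hN : Fact (2 * s < N)]

theorem critExp_pos : 0 < critExp N s := by linarith [two_lt_critExp hs.out hN.out]

theorem fact_one_le_critExp : Fact (1 ≤ ENNReal.ofReal (critExp N s)) :=
  ⟨by rw [ENNReal.one_le_ofReal]; linarith [two_lt_critExp hs.out hN.out]⟩

omit hs hN in
theorem memLp (u : HomSobolev N s) : MemLp u (ENNReal.ofReal (critExp N s)) volume :=
  Lp.memLp (toLp u)

theorem integrable_rpow (u : HomSobolev N s) : Integrable (fun x => |u x| ^ critExp N s) := by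
  have hp := critExp_pos (N := N) (s := s)
  have := u.memLp.integrable_norm_rpow (by simpa using hp) ENNReal.ofReal_ne_top
  simpa [ENNReal.toReal_ofReal hp.le] using this

theorem norm_sq_eq (u : HomSobolev N s) : ‖u‖ ^ 2 = ∫ z, gagliardoIntegrand s u u z := by
  rw [← real_inner_self_eq_norm_sq, inner_eq, gagliardoForm]

/-- The averaging estimate with level and radius adapted to `|u x|`, so that the terms without the
Gagliardo integrand are absorbed on the left. Integrating in x yields Sobolev. -/
theorem rpow_le_mul_integral (u : HomSobolev N s) {x : EuclideanSpace ℝ (Fin N)}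
    (hg : Integrable (fun y => gagliardoIntegrand s u u (x, y)))
    (hA : 0 < ∫ y, |u y| ^ critExp N s) :
    |u x| ^ critExp N s ≤ 2 ^ critExp N s * (2 / volume.real (Metric.ball (0 : EuclideanSpace ℝ (Fin N)) 1)) *
      (2 * (∫ y, |u y| ^ critExp N s) / volume.real (Metric.ball (0 : EuclideanSpace ℝ (Fin N)) 1))
        ^ (2 * s / N) * ∫ y, gagliardoIntegrand s u u (x, y) := by
  set p := critExp N s with hp
  have hp2 : 2 < p := two_lt_critExp hs.out hN.out
  have hs0 := hs.out
  have hN0 : (0 : ℝ) < N := by linarith [hN.out]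
  set ω := volume.real (Metric.ball (0 : EuclideanSpace ℝ (Fin N)) 1) with hω
  have hω0 : 0 < ω := 
    ENNReal.toReal_pos (Metric.measure_ball_pos _ _ one_pos).ne' measure_ball_lt_top.ne
  set A := ∫ y, |u y| ^ p with hAdef
  set g := ∫ y, gagliardoIntegrand s u u (x, y) with hgdef
  have hg0 : 0 ≤ g := integral_nonneg fun y => gagliardoIntegrand_self_nonneg s _ _
  rcases eq_or_ne (u x) 0 with h0 | h0
  · rw [h0, abs_zero, Real.zero_rpow (by linarith)]
    positivity
  -- With this level the left side of the averaging estimate is `4 l² |B|`, and the level term takes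
  -- only `2 l² |B|` of it.
  set l := |u x| / 2 with hl
  have hl0 : 0 < l := by positivity
  -- R is the N-th power of the radius, chosen so that `|B| = R ω` and `2 l^(2-p) A = l² |B|`. One
  -- copy of `l² |B|` then survives on the left.
  set R := 2 * A * l ^ (-p) / ω with hR
  have hR0 : 0 < R := by positivity
  set r := R ^ (1 / (N : ℝ)) with hr
  have hr0 : 0 < r := by positivity
  have hrN : r ^ (N : ℝ) = R := by
    rw [hr, ← Real.rpow_mul hR0.le, one_div_mul_cancel hN0.ne', Real.rpow_one]
  have hvol : volume.real (Metric.ball x r) = R * ω := by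
    rw [measureReal_def, Measure.addHaar_ball_of_pos _ _ hr0, finrank_euclideanSpace_fin, ← hrN,
      Real.rpow_natCast, ENNReal.toReal_mul, ENNReal.toReal_ofReal (by positivity), hω,
      measureReal_def]
  have hmain := volume_ball_mul_sq_le hs0 hp2.le hr0 hl0 hg u.integrable_rpow
  rw [hvol, ← hAdef, ← hgdef, Real.rpow_add hr0, hrN] at hmain
  have hux : u x ^ 2 = 4 * l ^ 2 := by rw [hl, div_pow, sq_abs]; ring
  have hl2 : l ^ (2 - p) * (2 * A) = R * ω * l ^ 2 := by
    rw [hR, sub_eq_add_neg, Real.rpow_add hl0, Real.rpow_two]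
    field_simp
  have h1 : R * (ω * l ^ 2) ≤ R * (2 * r ^ (2 * s) * g) := by
    rw [hux] at hmain
    nlinarith
  have h2 : ω * l ^ 2 ≤ 2 * r ^ (2 * s) * g := le_of_mul_le_mul_left h1 hR0
  have hrs : r ^ (2 * s) = (2 * A / ω) ^ (2 * s / N) * l ^ (-(p - 2)) := by
    rw [hr, ← Real.rpow_mul hR0.le, hR,
      show 2 * A * l ^ (-p) / ω = 2 * A / ω * l ^ (-p) by ring,
      Real.mul_rpow (by positivity) (by positivity), ← Real.rpow_mul hl0.le]
    congr 2
    · ring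
    · rw [← critExp_mul_eq hs.out hN.out]; ring
  rw [hrs] at h2
  have hxl : |u x| = 2 * l := by rw [hl]; ring
  rw [hxl, Real.mul_rpow zero_le_two hl0.le]
  have h3 : l ^ p = l ^ 2 * l ^ (p - 2) := by
    rw [← Real.rpow_two, ← Real.rpow_add hl0]; congr 1; ring
  have h4 : l ^ (-(p - 2)) * l ^ (p - 2) = 1 := by
    rw [← Real.rpow_add hl0]; simp
  have h5 : l ^ p ≤ 2 / ω * (2 * A / ω) ^ (2 * s / N) * g := by
    have h6 : 0 < l ^ (p - 2) := by positivity
    have h7 := mul_le_mul_of_nonneg_right h2 h6.le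
    rw [show 2 / ω * (2 * A / ω) ^ (2 * s / N) * g =
      2 * (2 * A / ω) ^ (2 * s / N) * g / ω by ring, le_div_iff₀ hω0, h3]
    calc l ^ 2 * l ^ (p - 2) * ω = ω * l ^ 2 * l ^ (p - 2) := by ring
      _ ≤ _ := h7
      _ = 2 * (2 * A / ω) ^ (2 * s / N) * g * (l ^ (-(p - 2)) * l ^ (p - 2)) := by ring
      _ = _ := by rw [h4, mul_one]
  calc 2 ^ p * l ^ p ≤ 2 ^ p * (2 / ω * (2 * A / ω) ^ (2 * s / N) * g) := by gcongr
    _ = _ := by ring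

/-- The fractional Sobolev inequality. -/
theorem exists_integral_rpow_le (N : ℕ) (s : ℝ) [hs : Fact (0 < s)] [hN : Fact (2 * s < N)] :
    ∃ S : ℝ, 0 < S ∧ ∀ u : HomSobolev N s,
      ∫ x, |u x| ^ critExp N s ≤ S * ‖u‖ ^ critExp N s := by
  set p := critExp N s with hp
  have hp2 : 2 < p := two_lt_critExp hs.out hN.out
  have hs0 := hs.out
  have hN0 : (0 : ℝ) < N := by linarith [hN.out]
  set ω := volume.real (Metric.ball (0 : EuclideanSpace ℝ (Fin N)) 1) with hω
  have hω0 : 0 < ω := 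
    ENNReal.toReal_pos (Metric.measure_ball_pos _ _ one_pos).ne' measure_ball_lt_top.ne
  set K : ℝ := 2 ^ p * (2 / ω) * (2 / ω) ^ (2 * s / N) with hK
  have hK0 : 0 < K := by positivity
  refine ⟨K ^ (p / 2), by positivity, fun u => ?_⟩
  set A := ∫ y, |u y| ^ p with hA
  have hA0 : 0 ≤ A := integral_nonneg fun y => by positivity
  -- The main case divides `A ≤ K A^(1-2/p) ‖u‖²` by a power of A, so A = 0 is treated apart.
  rcases hA0.eq_or_lt with h0 | h0
  · rw [← h0]; positivity
  have hi : Integrable (gagliardoIntegrand s u u)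
      ((volume : Measure (EuclideanSpace ℝ (Fin N))).prod volume) := u.integrable_self
  have h1 : A ≤ ∫ x, 2 ^ p * (2 / ω) * (2 * A / ω) ^ (2 * s / N) *
      ∫ y, gagliardoIntegrand s u u (x, y) := by
    refine integral_mono_ae u.integrable_rpow (hi.integral_prod_left.const_mul _) ?_
    filter_upwards [hi.prod_right_ae] with x hx using u.rpow_le_mul_integral hx h0
  have h2 : ∫ x, ∫ y, gagliardoIntegrand s u u (x, y) = ‖u‖ ^ 2 := by
    rw [norm_sq_eq]; exact (integral_prod _ hi).symm
  rw [integral_const_mul, h2, show 2 * A / ω = 2 / ω * A by ring,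
    Real.mul_rpow (by positivity) hA0, two_mul_div_eq_one_sub hs.out hN.out] at h1
  have h3 : A ^ (2 / p) ≤ K * ‖u‖ ^ 2 := by
    rw [two_mul_div_eq_one_sub hs.out hN.out, ← hp] at hK
    rw [← hp] at h1
    have hq : A ^ (1 - 2 / p) * A ^ (2 / p) = A := by
      rw [← Real.rpow_add h0]; simp
    have hq0 : 0 < A ^ (1 - 2 / p) := by positivity
    refine le_of_mul_le_mul_left ?_ hq0
    rw [hq, hK]
    calc A ≤ _ := h1
      _ = _ := by ring
  calc A = (A ^ (2 / p)) ^ (p / 2) := by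
        rw [← Real.rpow_mul hA0, div_mul_div_cancel₀ (by linarith), div_self two_ne_zero,
          Real.rpow_one]
    _ ≤ (K * ‖u‖ ^ 2) ^ (p / 2) := by gcongr
    _ = _ := by
        rw [Real.mul_rpow hK0.le (by positivity), ← Real.rpow_two, ← Real.rpow_mul (norm_nonneg _)]
        congr 2; ring

theorem norm_toLp_rpow (u : HomSobolev N s) :
    ‖toLp u‖ ^ critExp N s = ∫ x, |u x| ^ critExp N s := by
  have hp := critExp_pos (N := N) (s := s)
  have h0 : 0 ≤ ∫ x, |u x| ^ critExp N s := integral_nonneg fun x => by positivity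
  rw [Lp.norm_def, u.memLp.eLpNorm_eq_integral_rpow_norm (by simpa using hp)
    ENNReal.ofReal_ne_top, ENNReal.toReal_ofReal hp.le, ENNReal.toReal_ofReal (by positivity)]
  simp only [Real.norm_eq_abs]
  rw [← Real.rpow_mul h0, inv_mul_cancel₀ hp.ne', Real.rpow_one]

theorem exists_norm_toLp_le (N : ℕ) (s : ℝ) [hs : Fact (0 < s)] [hN : Fact (2 * s < N)] :
    ∃ C : ℝ, 0 < C ∧ ∀ u : HomSobolev N s, ‖toLp u‖ ≤ C * ‖u‖ := by
  obtain ⟨S, hS, h⟩ := exists_integral_rpow_le N s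
  have hp := critExp_pos (N := N) (s := s)
  refine ⟨S ^ (critExp N s)⁻¹, by positivity, fun u => ?_⟩
  have hfact : Fact (1 ≤ ENNReal.ofReal (critExp N s)) := fact_one_le_critExp
  have h1 := h u
  rw [← norm_toLp_rpow] at h1
  rw [← Real.rpow_le_rpow_iff (norm_nonneg _) (by positivity) hp,
    Real.mul_rpow (by positivity) (norm_nonneg _), ← Real.rpow_mul hS.le,
    inv_mul_cancel₀ hp.ne', Real.rpow_one]
  exact h1

/-! ### Completeness of the homogeneous Sobolev space. -/

omit hs hN in
theorem coeFn_sub (u v : HomSobolev N s) :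
    ⇑(toLp (u - v)) =ᵐ[volume] (u : _ → ℝ) - (v : _ → ℝ) :=
  Lp.coeFn_sub (toLp u) (toLp v)

/-- The element of the space given by a function. -/
def mk (u : EuclideanSpace ℝ (Fin N) → ℝ)
    (hu : MemLp u (ENNReal.ofReal (critExp N s)) volume)
    (hg : Integrable (gagliardoIntegrand s u u) volume) : HomSobolev N s :=
  ⟨hu.toLp u, hg.congr (gagliardoIntegrand_congr s hu.coeFn_toLp hu.coeFn_toLp).symm⟩

omit hs hN in
theorem coeFn_mk {u : EuclideanSpace ℝ (Fin N) → ℝ}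
    (hu : MemLp u (ENNReal.ofReal (critExp N s)) volume)
    (hg : Integrable (gagliardoIntegrand s u u) volume) :
    ⇑(toLp (mk u hu hg)) =ᵐ[volume] u :=
  hu.coeFn_toLp

theorem lintegral_gagliardoIntegrand (u : HomSobolev N s) :
    ∫⁻ z, ENNReal.ofReal (gagliardoIntegrand s u u z) = ENNReal.ofReal (‖u‖ ^ 2) := by
  rw [norm_sq_eq, ofReal_integral_eq_lintegral_ofReal u.integrable_self
    (Filter.Eventually.of_forall (gagliardoIntegrand_self_nonneg s _))]

/-- Lower semicontinuity of the Gagliardo energy along almost everywhere convergent sequences. -/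
theorem lintegral_le_of_tendsto_ae {u : EuclideanSpace ℝ (Fin N) → ℝ} (v : ℕ → HomSobolev N s)
    (hv : ∀ᵐ x, Filter.Tendsto (fun n => v n x) Filter.atTop (nhds (u x))) {c : ℝ}
    (hc : ∀ᶠ n in Filter.atTop, ‖v n‖ ≤ c) :
    ∫⁻ z, ENNReal.ofReal (gagliardoIntegrand s u u z) ≤ ENNReal.ofReal (c ^ 2) := by
  have hf := (Measure.quasiMeasurePreserving_fst
    (μ := (volume : Measure (EuclideanSpace ℝ (Fin N))))
    (ν := (volume : Measure (EuclideanSpace ℝ (Fin N))))).ae hv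
  have hs := (Measure.quasiMeasurePreserving_snd
    (μ := (volume : Measure (EuclideanSpace ℝ (Fin N))))
    (ν := (volume : Measure (EuclideanSpace ℝ (Fin N))))).ae hv
  calc ∫⁻ z, ENNReal.ofReal (gagliardoIntegrand s u u z)
      = ∫⁻ z, Filter.liminf
          (fun n => ENNReal.ofReal (gagliardoIntegrand s (v n) (v n) z)) Filter.atTop := by
        refine lintegral_congr_ae ?_
        filter_upwards [hf, hs] with z h1 h2
        refine (Filter.Tendsto.liminf_eq ?_).symm
        refine (ENNReal.continuous_ofReal.tendsto _).comp ?_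
        exact ((h1.sub h2).mul (h1.sub h2)).div_const _
    _ ≤ Filter.liminf (fun n => ∫⁻ z, ENNReal.ofReal (gagliardoIntegrand s (v n) (v n) z))
          Filter.atTop :=
        lintegral_liminf_le' fun n => (aestronglyMeasurable_gagliardoIntegrand s
          (v n).aestronglyMeasurable (v n).aestronglyMeasurable).aemeasurable.ennreal_ofReal
    _ ≤ ENNReal.ofReal (c ^ 2) := by
        refine Filter.liminf_le_of_le (by isBoundedDefault) fun b hb => ?_
        obtain ⟨n, h1, h2⟩ := (hb.and hc).exists
        rw [lintegral_gagliardoIntegrand] at h1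
        exact h1.trans (ENNReal.ofReal_le_ofReal (by gcongr))

/-- By Sobolev a Cauchy sequence converges in L^p, and a subsequence converges almost everywhere.
Fatou's lemma applied to the differences `u (φ k) - u n` shows both that the limit has finite energy
and that convergence holds in the Gagliardo norm. -/
instance : CompleteSpace (HomSobolev N s) := by
  have hfact : Fact (1 ≤ ENNReal.ofReal (critExp N s)) := fact_one_le_critExp
  obtain ⟨C, hC, hCu⟩ := exists_norm_toLp_le N s
  refine Metric.complete_of_cauchySeq_tendsto fun u hu => ?_
  have hLp : CauchySeq fun n => toLp (u n) := by
    rw [Metric.cauchySeq_iff] at hu ⊢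
    intro ε hε
    obtain ⟨K, hK⟩ := hu (ε / C) (by positivity)
    refine ⟨K, fun m hm n hn => ?_⟩
    have h1 := hK m hm n hn
    rw [dist_eq_norm, lt_div_iff₀ hC] at h1
    rw [dist_eq_norm]
    calc ‖toLp (u m) - toLp (u n)‖ ≤ C * ‖u m - u n‖ := hCu (u m - u n)
      _ < ε := by linarith
  obtain ⟨w, hw⟩ := cauchySeq_tendsto_of_complete hLp
  obtain ⟨φ, hφ, hae⟩ := (tendstoInMeasure_of_tendsto_Lp hw).exists_seq_tendsto_ae
  have hdiff : ∀ n, ∀ᵐ x, Filter.Tendsto (fun k => (u (φ k) - u n) x) Filter.atTop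
      (nhds ((w - toLp (u n) : Lp ℝ _ volume) x)) := by
    intro n
    have h1 : ∀ᵐ x, ∀ k, (u (φ k) - u n) x = u (φ k) x - u n x :=
      ae_all_iff.2 fun k => coeFn_sub (u (φ k)) (u n)
    filter_upwards [hae, h1, Lp.coeFn_sub w (toLp (u n))] with x h2 h3 h4
    simp only [h3, h4, Pi.sub_apply]
    exact h2.sub_const _
  have hfin : ∀ n, ∀ c, (∀ᶠ k in Filter.atTop, ‖u (φ k) - u n‖ ≤ c) →
      ∫⁻ z, ENNReal.ofReal (gagliardoIntegrand s (w - toLp (u n) : Lp ℝ _ volume)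
        (w - toLp (u n) : Lp ℝ _ volume) z) ≤ ENNReal.ofReal (c ^ 2) := fun n c hc =>
    lintegral_le_of_tendsto_ae (fun k => u (φ k) - u n) (hdiff n) hc
  have hCau : ∀ ε > 0, ∃ K, ∀ n ≥ K, ∀ᶠ k in Filter.atTop, ‖u (φ k) - u n‖ ≤ ε := by
    intro ε hε
    obtain ⟨K, hK⟩ := Metric.cauchySeq_iff.1 hu ε hε
    refine ⟨K, fun n hn => ?_⟩
    filter_upwards [Filter.eventually_ge_atTop K] with k hk
    rw [← dist_eq_norm]
    exact (hK _ (hk.trans (hφ.id_le k)) n hn).le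
  have hmem : ∀ n c, (∀ᶠ k in Filter.atTop, ‖u (φ k) - u n‖ ≤ c) →
      w - toLp (u n) ∈ homSobolevSubmodule N s := by
    intro n c hc
    have hm := Lp.aestronglyMeasurable (w - toLp (u n))
    refine ⟨aestronglyMeasurable_gagliardoIntegrand s hm hm, ?_⟩
    rw [hasFiniteIntegral_iff_ofReal
      (Filter.Eventually.of_forall (gagliardoIntegrand_self_nonneg s _))]
    exact (hfin n c hc).trans_lt ENNReal.ofReal_lt_top
  -- One finite-energy difference suffices: w is the sum of it and `u K`.
  obtain ⟨K, hK⟩ := hCau 1 one_pos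
  have hw' : w ∈ homSobolevSubmodule N s := by
    have := (homSobolevSubmodule N s).add_mem (hmem K 1 (hK K le_rfl)) (u K).2
    simpa [toLp] using this
  obtain ⟨w', hw''⟩ : ∃ w' : HomSobolev N s, toLp w' = w := ⟨⟨w, hw'⟩, rfl⟩
  refine ⟨w', ?_⟩
  rw [Metric.tendsto_atTop]
  intro ε hε
  obtain ⟨K, hK⟩ := hCau (ε / 2) (by positivity)
  refine ⟨K, fun n hn => ?_⟩
  have h1 := hfin n _ (hK n hn)
  have h2 := lintegral_gagliardoIntegrand (w' - u n)
  have h3 : ‖w' - u n‖ ^ 2 ≤ (ε / 2) ^ 2 := by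
    rw [← ENNReal.ofReal_le_ofReal_iff (by positivity), ← h2]
    subst hw''
    exact h1
  have h4 := abs_le_of_sq_le_sq h3 (by positivity)
  rw [dist_comm, dist_eq_norm]
  rw [abs_of_nonneg (norm_nonneg _)] at h4
  linarith

end HomSobolev

/-! ### Pointwise convexity inequalities for powers of the positive part. -/

/-- The convexity of `t ↦ (t_+) ^ p`, in gradient form. -/
theorem max_rpow_add_le {p : ℝ} (hp : 1 < p) (t τ : ℝ) :
    max t 0 ^ p + p * (max t 0 ^ (p - 1) * (τ - t)) ≤ max τ 0 ^ p := by
  have hp0 : 0 < p := by linarith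
  have ht : 0 ≤ max t 0 := le_max_right _ _
  have hτ : 0 ≤ max τ 0 := le_max_right _ _
  have h1 : max t 0 ^ (p - 1) * t = max t 0 ^ p := by
    rcases le_or_gt t 0 with h | h
    · rw [max_eq_right h, Real.zero_rpow (by linarith), Real.zero_rpow hp0.ne', zero_mul]
    · rw [max_eq_left h.le, ← Real.rpow_add_one h.ne']; congr 1; ring
  have h2 : max t 0 ^ (p - 1) * τ ≤ max t 0 ^ (p - 1) * max τ 0 := by
    gcongr; exact le_max_left _ _
  have hpq : p.HolderConjugate (p / (p - 1)) := Real.HolderConjugate.conjExponent hp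
  have h3 := Real.young_inequality_of_nonneg hτ (Real.rpow_nonneg ht (p - 1)) hpq
  rw [← Real.rpow_mul ht, mul_div_cancel₀ _ (by linarith : p - 1 ≠ 0)] at h3
  have h4 : max t 0 ^ p / (p / (p - 1)) = max t 0 ^ p * (p - 1) / p := by
    rw [div_div_eq_mul_div]
  rw [h4, ← add_div, le_div_iff₀ hp0] at h3
  rw [mul_sub, h1]
  nlinarith

/-- For τ ≤ t the tangent inequality at t applies, with slope at most `q R^(q-1)`; the other case is
symmetric. Used with q = p - 1, as a Lipschitz bound for the derivative. -/
theorem max_rpow_sub_mul_sub_le {q t τ R : ℝ} (hq : 1 < q) (ht : |t| ≤ R) (hτ : |τ| ≤ R) :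
    (max t 0 ^ q - max τ 0 ^ q) * (t - τ) ≤ q * R ^ (q - 1) * (t - τ) ^ 2 := by
  wlog h : τ ≤ t generalizing t τ with H
  · have := H hτ ht (le_of_not_ge h)
    calc _ = (max τ 0 ^ q - max t 0 ^ q) * (τ - t) := by ring
      _ ≤ _ := this
      _ = _ := by ring
  have hR : 0 ≤ R := (abs_nonneg _).trans ht
  have h1 := max_rpow_add_le hq t τ
  have h2 : max t 0 ^ (q - 1) ≤ R ^ (q - 1) := by
    apply Real.rpow_le_rpow (le_max_right _ _) _ (by linarith)
    exact max_le ((le_abs_self t).trans ht) hR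
  have h3 : max t 0 ^ q - max τ 0 ^ q ≤ q * R ^ (q - 1) * (t - τ) := by
    have : max t 0 ^ (q - 1) * (t - τ) ≤ R ^ (q - 1) * (t - τ) := by
      gcongr
    nlinarith
  nlinarith

/-- The tangent inequality at t bounds the increment using the slope at t; replacing it by the slope
at m costs the quadratic term. -/
theorem max_rpow_le_quadratic {p t m R : ℝ} (hp : 2 < p) (ht : |t| ≤ R) (hm : |m| ≤ R) :
    max t 0 ^ p ≤ max m 0 ^ p + p * (max m 0 ^ (p - 1) * (t - m)) +
      p * (p - 1) * R ^ (p - 2) * (t - m) ^ 2 := by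
  have h1 := max_rpow_add_le (by linarith : 1 < p) t m
  have h2 := max_rpow_sub_mul_sub_le (by linarith : 1 < p - 1) ht hm
  rw [show p - 1 - 1 = p - 2 by ring] at h2
  nlinarith

/-- A bound for the defect of convexity of `t ↦ (t_+) ^ p`. -/
theorem max_rpow_convexity_defect_le {p θ η : ℝ} (hp : 2 < p) (hθ : 0 ≤ θ) (hη : 0 ≤ η)
    (h1 : θ + η = 1) (t τ : ℝ) :
    θ * max t 0 ^ p + η * max τ 0 ^ p - max (θ * t + η * τ) 0 ^ p ≤
      p * (p - 1) * (θ * η) * (|t| ^ (p - 2) * |t - τ| ^ (2 : ℝ) +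
        |τ| ^ (p - 2) * |t - τ| ^ (2 : ℝ)) := by
  set m := θ * t + η * τ with hm
  set R := max |t| |τ| with hR
  have hR0 : 0 ≤ R := (abs_nonneg t).trans (le_max_left _ _)
  have hmR : |m| ≤ R := by
    calc |m| ≤ |θ * t| + |η * τ| := abs_add_le _ _
      _ = θ * |t| + η * |τ| := by rw [abs_mul, abs_mul, abs_of_nonneg hθ, abs_of_nonneg hη]
      _ ≤ θ * R + η * R := by gcongr; exacts [le_max_left _ _, le_max_right _ _]
      _ = R := by rw [← add_mul, h1, one_mul]
  have h2 := max_rpow_le_quadratic hp (le_max_left |t| |τ|) hmR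
  have h3 := max_rpow_le_quadratic hp (le_max_right |t| |τ|) hmR
  have hη' : η = 1 - θ := by linarith
  have ht : t - m = η * (t - τ) := by rw [hm, hη']; ring
  have hτ : τ - m = -(θ * (t - τ)) := by rw [hm, hη']; ring
  have h4 : R ^ (p - 2) ≤ |t| ^ (p - 2) + |τ| ^ (p - 2) := by
    have h5 : 0 ≤ |t| ^ (p - 2) := by positivity
    have h6 : 0 ≤ |τ| ^ (p - 2) := by positivity
    rcases max_choice |t| |τ| with h | h <;> rw [hR, h] <;> linarith
  rw [Real.rpow_two, sq_abs, ← add_mul]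
  set X := R ^ (p - 2)
  rw [ht] at h2
  rw [hτ] at h3
  -- In the weighted sum of the two expansions at m the first-order terms cancel, and `θ η² + η θ² =
  -- θ η`.
  have h7 : θ * max t 0 ^ p + η * max τ 0 ^ p - max m 0 ^ p ≤
      p * (p - 1) * (θ * η) * (X * (t - τ) ^ 2) := by
    have h8 := mul_le_mul_of_nonneg_left h2 hθ
    have h9 := mul_le_mul_of_nonneg_left h3 hη
    rw [hη'] at h8 h9 ⊢
    linear_combination h8 + h9
  refine h7.trans ?_
  have hpp : 0 ≤ p * (p - 1) := by nlinarith
  gcongr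

/-- Replace both bases by their maximum; the exponents add up to p. -/
theorem rpow_mul_rpow_le_add {p q w h : ℝ} (hq : 0 ≤ q) (hqp : q ≤ p) (hw : 0 ≤ w) (hh : 0 ≤ h) :
    w ^ (p - q) * h ^ q ≤ w ^ p + h ^ p := by
  have hM : 0 ≤ max w h := hw.trans (le_max_left _ _)
  have h1 : w ^ (p - q) * h ^ q ≤ max w h ^ (p - q) * max w h ^ q :=
    mul_le_mul (Real.rpow_le_rpow hw (le_max_left _ _) (by linarith))
      (Real.rpow_le_rpow hh (le_max_right _ _) hq) (by positivity) (by positivity)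
  rw [← Real.rpow_add_of_nonneg hM (by linarith) hq, sub_add_cancel] at h1
  have h2 : 0 ≤ w ^ p := by positivity
  have h3 : 0 ≤ h ^ p := by positivity
  rcases max_choice w h with h4 | h4 <;> rw [h4] at h1 <;> linarith

/-! ### Integral estimates for the nonlinear term. -/

namespace HomSobolev

variable {N : ℕ} {s : ℝ} [hs : Fact (0 < s)] [hN : Fact (2 * s < N)]

omit hs hN in
theorem coeFn_combination (θ η : ℝ) (u v : HomSobolev N s) :
    ∀ᵐ x, (θ • u + η • v) x = θ * u x + η * v x := by
  filter_upwards [coeFn_add (θ • u) (η • v), coeFn_smul θ u, coeFn_smul η v] with x h1 h2 h3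
  simp [h1, h2, h3]

theorem integrable_rpow_mul_rpow {q : ℝ} (hq : 0 ≤ q) (hqp : q ≤ critExp N s)
    (w h : HomSobolev N s) :
    Integrable (fun x => |w x| ^ (critExp N s - q) * |h x| ^ q) := by
  have h1 : AEMeasurable (fun x => |w x|) volume :=
    w.aestronglyMeasurable.aemeasurable.norm
  have h2 : AEMeasurable (fun x => |h x|) volume :=
    h.aestronglyMeasurable.aemeasurable.norm
  refine (w.integrable_rpow.add h.integrable_rpow).mono'
    ((h1.pow_const _).mul (h2.pow_const _)).aestronglyMeasurable
    (Filter.Eventually.of_forall fun x => ?_)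
  rw [Real.norm_of_nonneg (by positivity)]
  exact rpow_mul_rpow_le_add hq hqp (abs_nonneg _) (abs_nonneg _)

/-- A multiplicative form of the Sobolev inequality for mixed powers. -/
theorem integral_rpow_mul_rpow_le {S : ℝ}
    (hS : ∀ u : HomSobolev N s, ∫ x, |u x| ^ critExp N s ≤ S * ‖u‖ ^ critExp N s)
    {q R : ℝ} (hq : 0 < q) (hqp : q ≤ critExp N s) (hR : 0 < R)
    {w : HomSobolev N s} (hw : ‖w‖ ≤ R) (h : HomSobolev N s) :
    ∫ x, |w x| ^ (critExp N s - q) * |h x| ^ q ≤ 2 * S * R ^ (critExp N s - q) * ‖h‖ ^ q := by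
  set p := critExp N s with hp
  have hp0 : 0 < p := critExp_pos
  rcases eq_or_ne h 0 with rfl | hne
  · have : ∀ᵐ x, (0 : HomSobolev N s) x = 0 := Lp.coeFn_zero _ _ _
    rw [integral_congr_ae (g := fun _ => 0)]
    · simp [Real.zero_rpow hq.ne']
    · filter_upwards [this] with x hx
      simp [hx, Real.zero_rpow hq.ne']
  have hk : 0 < ‖h‖ := norm_pos_iff.2 hne
  set k := ‖h‖ with hkdef
  have hS0 : 0 ≤ S := by
    have h1 := hS h
    have h2 : 0 ≤ ∫ x, |h x| ^ p := integral_nonneg fun x => by positivity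
    exact nonneg_of_mul_nonneg_left (h2.trans h1) (by positivity)
  -- A substitute for Hölder: after dividing w by R and h by its norm, the additive bound becomes
  -- multiplicative, and each of its two terms contributes S.
  calc ∫ x, |w x| ^ (p - q) * |h x| ^ q
      ≤ ∫ x, (R ^ (p - q) * k ^ q) * ((R ^ p)⁻¹ * |w x| ^ p + (k ^ p)⁻¹ * |h x| ^ p) := by
        refine integral_mono (integrable_rpow_mul_rpow hq.le hqp w h)
          (((w.integrable_rpow.const_mul _).add (h.integrable_rpow.const_mul _)).const_mul _)
          fun x => ?_
        have h1 := rpow_mul_rpow_le_add hq.le hqp (div_nonneg (abs_nonneg (w x)) hR.le)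
          (div_nonneg (abs_nonneg (h x)) hk.le)
        have h2 : |w x| ^ (p - q) * |h x| ^ q =
            (R ^ (p - q) * k ^ q) * ((|w x| / R) ^ (p - q) * (|h x| / k) ^ q) := by
          rw [Real.div_rpow (abs_nonneg _) hR.le, Real.div_rpow (abs_nonneg _) hk.le]
          field_simp
        simp only
        rw [h2]
        refine mul_le_mul_of_nonneg_left (h1.trans_eq ?_) (by positivity)
        rw [Real.div_rpow (abs_nonneg _) hR.le, Real.div_rpow (abs_nonneg _) hk.le]
        ring
    _ = (R ^ (p - q) * k ^ q) *
          ((R ^ p)⁻¹ * (∫ x, |w x| ^ p) + (k ^ p)⁻¹ * ∫ x, |h x| ^ p) := by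
        rw [integral_const_mul, integral_add (w.integrable_rpow.const_mul _)
          (h.integrable_rpow.const_mul _), integral_const_mul, integral_const_mul]
    _ ≤ (R ^ (p - q) * k ^ q) * ((R ^ p)⁻¹ * (S * R ^ p) + (k ^ p)⁻¹ * (S * k ^ p)) := by
        have h3 : ∫ x, |w x| ^ p ≤ S * R ^ p := (hS w).trans (by gcongr)
        have h4 := hS h
        gcongr
    _ = _ := by
        have h5 : R ^ p ≠ 0 := by positivity
        have h6 : k ^ p ≠ 0 := by positivity
        field_simp
        ring

variable {a : EuclideanSpace ℝ (Fin N) → ℝ} {A S : ℝ}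

omit hs hN in
theorem aemeasurable_max (u : HomSobolev N s) : AEMeasurable (fun x => max (u x) 0) volume :=
  u.aestronglyMeasurable.aemeasurable.max aemeasurable_const

theorem integrable_weight_max_rpow (ha : AEStronglyMeasurable a volume) (hA : ∀ᵐ x, |a x| ≤ A)
    (u : HomSobolev N s) : Integrable (fun x => a x * max (u x) 0 ^ critExp N s) := by
  refine (u.integrable_rpow.const_mul A).mono'
    (ha.mul (u.aemeasurable_max.pow_const _).aestronglyMeasurable) ?_
  filter_upwards [hA] with x hx
  rw [norm_mul, Real.norm_eq_abs, Real.norm_of_nonneg (by positivity)]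
  have : max (u x) 0 ≤ |u x| := max_le (le_abs_self _) (abs_nonneg _)
  have hp := critExp_pos (N := N) (s := s)
  gcongr
  exact (abs_nonneg _).trans hx

theorem norm_weight_max_rpow_mul_le (hA : ∀ᵐ x, |a x| ≤ A) (u φ : HomSobolev N s) :
    ∀ᵐ x, ‖a x * (max (u x) 0 ^ (critExp N s - 1) * φ x)‖ ≤
      A * (|u x| ^ (critExp N s - 1) * |φ x| ^ (1 : ℝ)) := by
  filter_upwards [hA] with x hx
  rw [norm_mul, norm_mul, Real.norm_eq_abs, Real.norm_of_nonneg (by positivity), Real.rpow_one]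
  have : max (u x) 0 ≤ |u x| := max_le (le_abs_self _) (abs_nonneg _)
  have hp := two_lt_critExp hs.out hN.out
  have h0 : 0 ≤ A := (abs_nonneg _).trans hx
  have h1 : 0 ≤ max (u x) 0 := le_max_right _ _
  gcongr
  · linarith
  · exact le_rfl

theorem integrable_weight_max_rpow_mul (ha : AEStronglyMeasurable a volume)
    (hA : ∀ᵐ x, |a x| ≤ A) (u φ : HomSobolev N s) :
    Integrable (fun x => a x * (max (u x) 0 ^ (critExp N s - 1) * φ x)) := by
  have hp := two_lt_critExp hs.out hN.out
  exact ((integrable_rpow_mul_rpow zero_le_one (by linarith) u φ).const_mul A).mono'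
    (ha.mul ((u.aemeasurable_max.pow_const _).aestronglyMeasurable.mul φ.aestronglyMeasurable))
    (norm_weight_max_rpow_mul_le hA u φ)

omit hs hN in
theorem integral_weight_max_rpow_nonneg (ha0 : ∀ᵐ x, 0 ≤ a x) (u : HomSobolev N s) :
    0 ≤ ∫ x, a x * max (u x) 0 ^ critExp N s := by
  refine integral_nonneg_of_ae ?_
  filter_upwards [ha0] with x hx
  simp only [Pi.zero_apply]
  positivity

theorem integral_weight_max_rpow_le (ha : AEStronglyMeasurable a volume) (hA0 : 0 ≤ A)
    (hA : ∀ᵐ x, |a x| ≤ A)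
    (hS : ∀ u : HomSobolev N s, ∫ x, |u x| ^ critExp N s ≤ S * ‖u‖ ^ critExp N s)
    (u : HomSobolev N s) :
    ∫ x, a x * max (u x) 0 ^ critExp N s ≤ A * (S * ‖u‖ ^ critExp N s) := by
  have hp := critExp_pos (N := N) (s := s)
  calc ∫ x, a x * max (u x) 0 ^ critExp N s ≤ ∫ x, A * |u x| ^ critExp N s := by
        refine integral_mono_ae (integrable_weight_max_rpow ha hA u)
          (u.integrable_rpow.const_mul A) ?_
        filter_upwards [hA] with x hx
        have : max (u x) 0 ≤ |u x| := max_le (le_abs_self _) (abs_nonneg _)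
        have h1 : a x ≤ A := (le_abs_self _).trans hx
        have h2 : 0 ≤ max (u x) 0 := le_max_right _ _
        gcongr
    _ = A * ∫ x, |u x| ^ critExp N s := integral_const_mul _ _
    _ ≤ _ := by gcongr; exact hS u

/-- The integrated tangent inequality. It gives both the Lipschitz bound on balls and the one-sided
expansion behind the Euler-Lagrange equation. -/
theorem integral_weight_max_rpow_add_le (ha : AEStronglyMeasurable a volume)
    (hA : ∀ᵐ x, |a x| ≤ A) (ha0 : ∀ᵐ x, 0 ≤ a x) (u v : HomSobolev N s) :
    (∫ x, a x * max (u x) 0 ^ critExp N s) +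
      critExp N s * (∫ x, a x * (max (u x) 0 ^ (critExp N s - 1) * (v - u) x)) ≤
      ∫ x, a x * max (v x) 0 ^ critExp N s := by
  have hp := two_lt_critExp hs.out hN.out
  have hi := integrable_weight_max_rpow ha hA u
  have hi' := (integrable_weight_max_rpow_mul ha hA u (v - u)).const_mul (critExp N s)
  rw [← integral_const_mul, ← integral_add hi hi']
  refine integral_mono_ae (hi.add hi') (integrable_weight_max_rpow ha hA v) ?_
  filter_upwards [ha0, coeFn_sub v u] with x hx h1
  simp only [h1, Pi.sub_apply]
  have := mul_le_mul_of_nonneg_left (max_rpow_add_le (by linarith : 1 < critExp N s) (u x) (v x)) hx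
  linarith

/-- The defect of convexity of the nonlinear term on a ball. -/
theorem integral_weight_convexity_defect_le (ha : AEStronglyMeasurable a volume) (hA0 : 0 ≤ A)
    (hA : ∀ᵐ x, |a x| ≤ A) (ha0 : ∀ᵐ x, 0 ≤ a x)
    (hS : ∀ u : HomSobolev N s, ∫ x, |u x| ^ critExp N s ≤ S * ‖u‖ ^ critExp N s)
    {R : ℝ} (hR : 0 < R) {u v : HomSobolev N s} (hu : ‖u‖ ≤ R) (hv : ‖v‖ ≤ R)
    {θ η : ℝ} (hθ : 0 ≤ θ) (hη : 0 ≤ η) (h1 : θ + η = 1) :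
    θ * (∫ x, a x * max (u x) 0 ^ critExp N s) + η * (∫ x, a x * max (v x) 0 ^ critExp N s) -
      (∫ x, a x * max ((θ • u + η • v) x) 0 ^ critExp N s) ≤
      critExp N s * (critExp N s - 1) * (θ * η) *
        (4 * A * S * R ^ (critExp N s - 2) * ‖u - v‖ ^ 2) := by
  set p := critExp N s with hp
  have hp2 : 2 < p := two_lt_critExp hs.out hN.out
  have hiu := (integrable_weight_max_rpow ha hA u).const_mul θ
  have hiv := (integrable_weight_max_rpow ha hA v).const_mul η
  have hiw := integrable_weight_max_rpow ha hA (θ • u + η • v)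
  have hiuv : Integrable (fun x => θ * (a x * max (u x) 0 ^ critExp N s) +
    η * (a x * max (v x) 0 ^ critExp N s)) := hiu.add hiv
  have hju := integrable_rpow_mul_rpow zero_le_two hp2.le u (u - v)
  have hjv := integrable_rpow_mul_rpow zero_le_two hp2.le v (u - v)
  have hbu := integral_rpow_mul_rpow_le hS two_pos hp2.le hR hu (u - v)
  have hbv := integral_rpow_mul_rpow_le hS two_pos hp2.le hR hv (u - v)
  have hc : 0 ≤ A * (p * (p - 1) * (θ * η)) := by
    have : 0 ≤ p * (p - 1) := by nlinarith
    positivity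
  calc _ = ∫ x, (θ * (a x * max (u x) 0 ^ p) + η * (a x * max (v x) 0 ^ p) -
          a x * max ((θ • u + η • v) x) 0 ^ p) := by
        rw [integral_sub hiuv hiw, integral_add hiu hiv, integral_const_mul,
          integral_const_mul]
    _ ≤ ∫ x, A * (p * (p - 1) * (θ * η)) * (|u x| ^ (p - 2) * |(u - v) x| ^ (2 : ℝ) +
          |v x| ^ (p - 2) * |(u - v) x| ^ (2 : ℝ)) := by
        refine integral_mono_ae (hiuv.sub hiw) ((hju.add hjv).const_mul _) ?_
        filter_upwards [hA, ha0, coeFn_sub u v, coeFn_combination θ η u v] with x h2 h3 h4 h5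
        simp only [h4, h5, Pi.sub_apply]
        have h6 := max_rpow_convexity_defect_le hp2 hθ hη h1 (u x) (v x)
        have h7 : a x ≤ A := (le_abs_self _).trans h2
        set D := |u x| ^ (p - 2) * |u x - v x| ^ (2 : ℝ) + |v x| ^ (p - 2) * |u x - v x| ^ (2 : ℝ)
        have hD : 0 ≤ D := by positivity
        have h8 : 0 ≤ p * (p - 1) * (θ * η) * D := by
          have : 0 ≤ p * (p - 1) := by nlinarith
          positivity
        calc _ = a x * (θ * max (u x) 0 ^ p + η * max (v x) 0 ^ p -
              max (θ * u x + η * v x) 0 ^ p) := by ring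
          _ ≤ a x * (p * (p - 1) * (θ * η) * D) := by gcongr
          _ ≤ A * (p * (p - 1) * (θ * η) * D) := by gcongr
          _ = _ := by ring
    _ = A * (p * (p - 1) * (θ * η)) * ((∫ x, |u x| ^ (p - 2) * |(u - v) x| ^ (2 : ℝ)) +
          ∫ x, |v x| ^ (p - 2) * |(u - v) x| ^ (2 : ℝ)) := by
        rw [integral_const_mul, integral_add hju hjv]
    _ ≤ A * (p * (p - 1) * (θ * η)) * (2 * S * R ^ (p - 2) * ‖u - v‖ ^ (2 : ℝ) +
          2 * S * R ^ (p - 2) * ‖u - v‖ ^ (2 : ℝ)) := by gcongr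
    _ = _ := by rw [Real.rpow_two]; ring

/-- The nonlinear term is Lipschitz on balls. -/
theorem integral_weight_max_rpow_sub_le (ha : AEStronglyMeasurable a volume) (hA0 : 0 ≤ A)
    (hA : ∀ᵐ x, |a x| ≤ A) (ha0 : ∀ᵐ x, 0 ≤ a x)
    (hS : ∀ u : HomSobolev N s, ∫ x, |u x| ^ critExp N s ≤ S * ‖u‖ ^ critExp N s)
    {R : ℝ} (hR : 0 < R) {u : HomSobolev N s} (hu : ‖u‖ ≤ R) (v : HomSobolev N s) :
    (∫ x, a x * max (u x) 0 ^ critExp N s) - (∫ x, a x * max (v x) 0 ^ critExp N s) ≤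
      critExp N s * (A * (2 * S * R ^ (critExp N s - 1))) * ‖u - v‖ := by
  have hp := two_lt_critExp hs.out hN.out
  -- The tangent is taken at u, so only the norm of u needs a bound.
  have h1 := integral_weight_max_rpow_add_le ha hA ha0 u v
  have h2 : ‖∫ x, a x * (max (u x) 0 ^ (critExp N s - 1) * (v - u) x)‖ ≤
      A * (2 * S * R ^ (critExp N s - 1) * ‖v - u‖ ^ (1 : ℝ)) := by
    have h3 := integral_rpow_mul_rpow_le hS one_pos (by linarith) hR hu (v - u)
    refine (norm_integral_le_of_norm_le ((integrable_rpow_mul_rpow zero_le_one (by linarith) u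
      (v - u)).const_mul A) (norm_weight_max_rpow_mul_le hA u (v - u))).trans ?_
    rw [integral_const_mul]
    gcongr
  rw [Real.rpow_one, norm_sub_rev, Real.norm_eq_abs] at h2
  have h4 := (abs_le.1 h2).1
  have h5 : 0 < critExp N s := by linarith
  have h6 := mul_le_mul_of_nonneg_left h4 h5.le
  linarith

end HomSobolev

/-! ### Minimisation of strongly convex functions. -/

/-- A continuous strongly convex function that is bounded below attains its minimum. -/
theorem StrongConvexOn.exists_isMinOn {H : Type*} [NormedAddCommGroup H] [NormedSpace ℝ H]
    [CompleteSpace H] {K : Set H} {m : ℝ} {I : H → ℝ} (hI : StrongConvexOn K m I) (hm : 0 < m)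
    (hK : IsClosed K) (hne : K.Nonempty) (hc : ContinuousOn I K) (hb : BddBelow (I '' K)) :
    ∃ u ∈ K, IsMinOn I K u := by
  obtain ⟨hconv, hI⟩ := hI
  set M := sInf (I '' K) with hM
  have hMle : ∀ v ∈ K, M ≤ I v := fun v hv => csInf_le hb ⟨v, hv, rfl⟩
  have hex : ∀ n : ℕ, ∃ v ∈ K, I v < M + 1 / ((n : ℝ) + 1) := fun n => by
    obtain ⟨_, ⟨v, hv, rfl⟩, h⟩ := exists_lt_of_csInf_lt (hne.image I)
      (show M < M + 1 / ((n : ℝ) + 1) from lt_add_of_pos_right _ (by positivity))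
    exact ⟨v, hv, h⟩
  choose u huK hu using hex
  -- Compare the infimum with the value at the midpoint; the factor is `m / 8 = (1/2) (1/2) (m /
  -- 2)`.
  have hdist : ∀ n, ∀ j ≥ n, ∀ k ≥ n, m / 8 * ‖u j - u k‖ ^ 2 ≤ 1 / ((n : ℝ) + 1) := by
    intro n j hj k hk
    have h1 := hI (huK j) (huK k) (a := 1 / 2) (b := 1 / 2) (by norm_num) (by norm_num)
      (by norm_num)
    have h2 := hMle _ (hconv (huK j) (huK k) (a := 1 / 2) (b := 1 / 2) (by norm_num) (by norm_num)
      (by norm_num))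
    simp only [smul_eq_mul] at h1
    have h3 : 1 / ((j : ℝ) + 1) ≤ 1 / ((n : ℝ) + 1) := by gcongr
    have h4 : 1 / ((k : ℝ) + 1) ≤ 1 / ((n : ℝ) + 1) := by gcongr
    have h5 := hu j
    have h6 := hu k
    linarith
  have hcau : CauchySeq u := by
    rw [Metric.cauchySeq_iff]
    intro ε hε
    obtain ⟨n, hn⟩ := exists_nat_one_div_lt (show 0 < m / 8 * ε ^ 2 by positivity)
    refine ⟨n, fun j hj k hk => ?_⟩
    have h1 := (hdist n j hj k hk).trans_lt hn
    rw [dist_eq_norm]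
    exact lt_of_pow_lt_pow_left₀ 2 hε.le (lt_of_mul_lt_mul_left h1 (by positivity))
  obtain ⟨w, hw⟩ := cauchySeq_tendsto_of_complete hcau
  have hwK : w ∈ K := hK.mem_of_tendsto hw (Filter.Eventually.of_forall huK)
  refine ⟨w, hwK, fun v hv => le_trans ?_ (hMle v hv)⟩
  have h1 : Filter.Tendsto (fun n => I (u n)) Filter.atTop (nhds (I w)) :=
    (hc w hwK).tendsto.comp
      (tendsto_nhdsWithin_iff.2 ⟨hw, Filter.Eventually.of_forall huK⟩)
  have h2 : Filter.Tendsto (fun n : ℕ => M + 1 / ((n : ℝ) + 1)) Filter.atTop (nhds (M + 0)) :=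
    tendsto_one_div_add_atTop_nhds_zero_nat.const_add M
  rw [add_zero] at h2
  exact le_of_tendsto_of_tendsto' h1 h2 fun n => (hu n).le

theorem eq_zero_of_quadratic_nonneg {D c δ : ℝ} (hδ : 0 < δ)
    (h : ∀ t, |t| < δ → 0 ≤ t * D + t ^ 2 * c) : D = 0 := by
  have h1 : HasDerivAt (fun t : ℝ => t * D + t ^ 2 * c) D 0 :=
    (((hasDerivAt_id' (0 : ℝ)).mul_const D).add
      (((hasDerivAt_id' (0 : ℝ)).pow 2).mul_const c)).congr_deriv (by simp)
  refine IsLocalMin.hasDerivAt_eq_zero ?_ h1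
  filter_upwards [Metric.ball_mem_nhds (0 : ℝ) hδ] with t ht
  have := h t (by simpa using ht)
  simpa using this

/-! ### The truncated energy on small balls and its critical points. -/

namespace HomSobolev

variable {N : ℕ} {s : ℝ} [hs : Fact (0 < s)] [hN : Fact (2 * s < N)]
variable {a : EuclideanSpace ℝ (Fin N) → ℝ} {A S : ℝ}

/-- On small balls the nonlinear term is dominated by the quadratic one. -/
theorem exists_strongConvexOn (ha : AEStronglyMeasurable a volume)
    (hA : ∀ᵐ x, |a x| ≤ A) (hA0 : 0 < A) (ha0 : ∀ᵐ x, 0 ≤ a x) (hS0 : 0 < S)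
    (hS : ∀ u : HomSobolev N s, ∫ x, |u x| ^ critExp N s ≤ S * ‖u‖ ^ critExp N s) :
    ∃ r : ℝ, 0 < r ∧
      (∀ f : StrongDual ℝ (HomSobolev N s),
        StrongConvexOn (Metric.closedBall (0 : HomSobolev N s) r) (1 / 2)
          (truncatedEnergy a f)) ∧
      ∀ u : HomSobolev N s, ‖u‖ ≤ r →
        1 / critExp N s * (∫ x, a x * max (u x) 0 ^ critExp N s) ≤ 1 / 4 * ‖u‖ ^ 2 := by
  have hp2 : 2 < critExp N s := two_lt_critExp hs.out hN.out
  -- The radius will satisfy `r^(p-2) = c`, which reduces the factor `4 (p-1) A S r^(p-2)` in the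
  -- convexity defect to 1/4.
  set c : ℝ := 1 / (16 * (critExp N s - 1) * (A * S)) with hc
  have hp1 : 0 < critExp N s - 1 := by linarith
  have hc0 : 0 < c := by positivity
  set r : ℝ := c ^ (1 / (critExp N s - 2)) with hr
  have hr0 : 0 < r := by positivity
  have hrp : r ^ (critExp N s - 2) = c := by
    rw [hr, ← Real.rpow_mul hc0.le, one_div_mul_cancel (by linarith), Real.rpow_one]
  refine ⟨r, hr0, fun f => ⟨convex_closedBall _ _, ?_⟩, fun u hu => ?_⟩
  · intro u hu v hv θ η hθ hη h1
    rw [mem_closedBall_zero_iff] at hu hv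
    have h2 := integral_weight_convexity_defect_le ha hA0.le hA ha0 hS hr0 hu hv hθ hη h1
    rw [hrp] at h2
    have h3 : critExp N s * (critExp N s - 1) * (θ * η) * (4 * A * S * c * ‖u - v‖ ^ 2) =
        critExp N s * (1 / 4 * (θ * η) * ‖u - v‖ ^ 2) := by
      rw [hc]; field_simp; ring
    rw [h3] at h2
    have h4 : ‖θ • u + η • v‖ ^ 2 = θ * ‖u‖ ^ 2 + η * ‖v‖ ^ 2 - θ * η * ‖u - v‖ ^ 2 := by
      have hη' : η = 1 - θ := by linarith
      rw [norm_add_sq_real, norm_sub_sq_real, norm_smul, norm_smul, mul_pow, mul_pow,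
        real_inner_smul_left, real_inner_smul_right, Real.norm_eq_abs, Real.norm_eq_abs, sq_abs,
        sq_abs, hη']
      ring
    simp only [truncatedEnergy, smul_eq_mul, map_add, map_smul, h4]
    set X := ∫ x, a x * max (u x) 0 ^ critExp N s
    set Y := ∫ x, a x * max (v x) 0 ^ critExp N s
    set Z := ∫ x, a x * max ((θ • u + η • v) x) 0 ^ critExp N s
    -- The quadratic part supplies `(1/2) θ η ‖u - v‖²`. The defect uses at most half of it, leaving
    -- `(1/4) θ η ‖u - v‖²`, which is modulus 1/2.
    have h5 : 1 / critExp N s * (θ * X + η * Y - Z) ≤ 1 / 4 * (θ * η) * ‖u - v‖ ^ 2 := by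
      rw [one_div_mul_eq_div, div_le_iff₀ (by linarith)]
      linarith
    linarith
  · have h1 := integral_weight_max_rpow_le ha hA0.le hA hS u
    rw [one_div_mul_eq_div, div_le_iff₀ (by linarith)]
    have h2 : ‖u‖ ^ critExp N s ≤ c * ‖u‖ ^ 2 := by
      rcases (norm_nonneg u).eq_or_lt with h0 | h0
      · rw [← h0, Real.zero_rpow (by linarith)]; positivity
      · rw [← hrp, ← Real.rpow_two ‖u‖, ← sub_add_cancel (critExp N s) 2, Real.rpow_add h0,
          sub_add_cancel]
        gcongr
    have h3 : A * (S * (c * ‖u‖ ^ 2)) = 1 / (16 * (critExp N s - 1)) * ‖u‖ ^ 2 := by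
      rw [hc]; field_simp
    have h4 : 1 / (16 * (critExp N s - 1)) ≤ 1 / 16 := by
      gcongr; linarith
    calc _ ≤ A * (S * ‖u‖ ^ critExp N s) := h1
      _ ≤ A * (S * (c * ‖u‖ ^ 2)) := by gcongr
      _ ≤ 1 / 16 * ‖u‖ ^ 2 := by rw [h3]; gcongr
      _ ≤ _ := by nlinarith [sq_nonneg ‖u‖]

theorem continuousOn_truncatedEnergy (ha : AEStronglyMeasurable a volume)
    (hA : ∀ᵐ x, |a x| ≤ A) (hA0 : 0 < A) (ha0 : ∀ᵐ x, 0 ≤ a x)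
    (hS : ∀ u : HomSobolev N s, ∫ x, |u x| ^ critExp N s ≤ S * ‖u‖ ^ critExp N s)
    (f : StrongDual ℝ (HomSobolev N s)) {r : ℝ} (hr : 0 < r) :
    ContinuousOn (truncatedEnergy a f) (Metric.closedBall (0 : HomSobolev N s) r) := by
  have h : LipschitzOnWith (Real.toNNReal
      (critExp N s * (A * (2 * S * r ^ (critExp N s - 1)))))
      (fun u : HomSobolev N s => ∫ x, a x * max (u x) 0 ^ critExp N s)
      (Metric.closedBall (0 : HomSobolev N s) r) := by
    refine LipschitzOnWith.of_le_add_mul' _ fun u hu v hv => ?_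
    rw [mem_closedBall_zero_iff] at hu hv
    have := integral_weight_max_rpow_sub_le ha hA0.le hA ha0 hS hr hu v
    rw [dist_eq_norm]
    linarith
  unfold truncatedEnergy
  have h1 := h.continuousOn
  have h2 : Continuous (fun u : HomSobolev N s => 1 / 2 * ‖u‖ ^ 2) := by fun_prop
  exact (h2.continuousOn.sub (h1.const_mul _)).sub f.continuous.continuousOn

/-- The Euler-Lagrange equation of the truncated energy at an interior minimum. -/
theorem euler_lagrange (ha : AEStronglyMeasurable a volume)
    (hA : ∀ᵐ x, |a x| ≤ A) (ha0 : ∀ᵐ x, 0 ≤ a x) {f : StrongDual ℝ (HomSobolev N s)} {r : ℝ}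
    {u : HomSobolev N s} (hu : u ∈ Metric.ball (0 : HomSobolev N s) r)
    (hmin : IsMinOn (truncatedEnergy a f) (Metric.ball (0 : HomSobolev N s) r) u)
    (φ : HomSobolev N s) :
    inner ℝ u φ = (∫ x, a x * (max (u x) 0 ^ (critExp N s - 1) * φ x)) + f φ := by
  have hp2 := two_lt_critExp hs.out hN.out
  rw [mem_ball_zero_iff] at hu
  -- The nonlinear term enters with a minus sign and is convex, so its tangent bounds the energy
  -- increment from above; the only second-order term left comes from the norm. No differentiation
  -- under the integral is needed. The `+ 1` covers φ = 0.
  have key : ∀ t, |t| < (r - ‖u‖) / (‖φ‖ + 1) →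
      0 ≤ t * (inner ℝ u φ - ((∫ x, a x * (max (u x) 0 ^ (critExp N s - 1) * φ x)) + f φ)) +
        t ^ 2 * (1 / 2 * ‖φ‖ ^ 2) := by
    intro t ht
    rw [lt_div_iff₀ (by positivity)] at ht
    have hmem : u + t • φ ∈ Metric.ball (0 : HomSobolev N s) r := by
      rw [mem_ball_zero_iff]
      calc ‖u + t • φ‖ ≤ ‖u‖ + ‖t • φ‖ := norm_add_le _ _
        _ = ‖u‖ + |t| * ‖φ‖ := by rw [norm_smul, Real.norm_eq_abs]
        _ < r := by nlinarith [abs_nonneg t]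
    have h1 : truncatedEnergy a f u ≤ truncatedEnergy a f (u + t • φ) := hmin hmem
    have h2 := integral_weight_max_rpow_add_le ha hA ha0 u (u + t • φ)
    have h3 : ∫ x, a x * (max (u x) 0 ^ (critExp N s - 1) * (u + t • φ - u) x) =
        t * ∫ x, a x * (max (u x) 0 ^ (critExp N s - 1) * φ x) := by
      rw [add_sub_cancel_left, ← integral_const_mul]
      refine integral_congr_ae ?_
      filter_upwards [coeFn_smul t φ] with x hx
      simp only [hx, Pi.smul_apply, smul_eq_mul]
      ring
    rw [h3] at h2
    simp only [truncatedEnergy, norm_add_sq_real, real_inner_smul_right, norm_smul, map_add,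
      map_smul, smul_eq_mul, mul_pow, Real.norm_eq_abs, sq_abs] at h1
    set X := ∫ x, a x * max (u x) 0 ^ critExp N s
    set Y := ∫ x, a x * max ((u + t • φ) x) 0 ^ critExp N s
    set Z := ∫ x, a x * (max (u x) 0 ^ (critExp N s - 1) * φ x)
    have h4 : t * Z ≤ 1 / critExp N s * (Y - X) := by
      rw [one_div_mul_eq_div, le_div_iff₀ (by linarith)]
      linarith
    linarith
  have := eq_zero_of_quadratic_nonneg (div_pos (by linarith) (by positivity)) key
  linarith

/-! ### Positive parts and nonnegativity. -/

omit hs hN in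
/-- The positive part of an element of the space. -/
theorem exists_posPart (w : HomSobolev N s) :
    ∃ w' : HomSobolev N s, ∀ᵐ x, w' x = max (w x) 0 := by
  have hm : AEStronglyMeasurable (fun x => max (w x) 0) volume :=
    w.aemeasurable_max.aestronglyMeasurable
  have h1 : MemLp (fun x => max (w x) 0) (ENNReal.ofReal (critExp N s)) volume :=
    w.memLp.mono hm (Filter.Eventually.of_forall fun x => by
      rw [Real.norm_of_nonneg (le_max_right _ _)]
      exact max_le (le_abs_self _) (abs_nonneg _))
  have h2 : Integrable (gagliardoIntegrand s (fun x => max (w x) 0) (fun x => max (w x) 0))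
      volume := by
    refine w.integrable_self.mono (aestronglyMeasurable_gagliardoIntegrand s hm hm)
      (Filter.Eventually.of_forall fun z => ?_)
    rw [Real.norm_of_nonneg (gagliardoIntegrand_self_nonneg s _ z),
      Real.norm_of_nonneg (gagliardoIntegrand_self_nonneg s _ z)]
    refine div_le_div_of_nonneg_right ?_ (by positivity)
    refine abs_le_iff_mul_self_le.1 ?_
    exact abs_max_sub_max_le_abs _ _ _
  exact ⟨mk _ h1 h2, coeFn_mk h1 h2⟩

/-- The interaction of the positive and negative parts of a function. -/
def crossIntegrand (s : ℝ) (w : EuclideanSpace ℝ (Fin N) → ℝ)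
    (z : EuclideanSpace ℝ (Fin N) × EuclideanSpace ℝ (Fin N)) : ℝ :=
  (max (-w z.1) 0 * max (w z.2) 0 + max (w z.1) 0 * max (-w z.2) 0) /
    ‖z.1 - z.2‖ ^ ((N : ℝ) + 2 * s)

omit hs hN in
theorem crossIntegrand_nonneg (w : EuclideanSpace ℝ (Fin N) → ℝ)
    (z : EuclideanSpace ℝ (Fin N) × EuclideanSpace ℝ (Fin N)) : 0 ≤ crossIntegrand s w z := by
  unfold crossIntegrand; positivity

omit hs hN in
-- Since w - w_+ = -w_-, the difference is the integrand of -w_- against w_+; the products at equal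
-- points vanish and only the mixed ones remain.
theorem crossIntegrand_ae_eq {w w' : HomSobolev N s} (h : ∀ᵐ x, w' x = max (w x) 0) :
    crossIntegrand s w =ᵐ[volume]
      gagliardoIntegrand s w w' - gagliardoIntegrand s w' w' := by
  have h1 := (Measure.quasiMeasurePreserving_fst
    (μ := (volume : Measure (EuclideanSpace ℝ (Fin N))))
    (ν := (volume : Measure (EuclideanSpace ℝ (Fin N))))).ae h
  have h2 := (Measure.quasiMeasurePreserving_snd
    (μ := (volume : Measure (EuclideanSpace ℝ (Fin N))))
    (ν := (volume : Measure (EuclideanSpace ℝ (Fin N))))).ae h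
  filter_upwards [h1, h2] with z h3 h4
  simp only [crossIntegrand, gagliardoIntegrand, Pi.sub_apply, h3, h4, ← sub_div]
  congr 1
  rcases le_total (w z.1) 0 with h5 | h5 <;> rcases le_total (w z.2) 0 with h6 | h6 <;>
    simp [h5, h6] <;> ring

omit hs hN in
theorem integrable_crossIntegrand {w w' : HomSobolev N s} (h : ∀ᵐ x, w' x = max (w x) 0) :
    Integrable (crossIntegrand s w) :=
  ((integrable_pair w w').sub w'.integrable_self).congr (crossIntegrand_ae_eq h).symm

theorem inner_posPart {w w' : HomSobolev N s} (h : ∀ᵐ x, w' x = max (w x) 0) :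
    inner ℝ w w' = ‖w'‖ ^ 2 + ∫ z, crossIntegrand s w z := by
  rw [integral_congr_ae (crossIntegrand_ae_eq h), norm_sq_eq, inner_eq, gagliardoForm]
  simp only [Pi.sub_apply]
  rw [integral_sub (integrable_pair w w') w'.integrable_self]
  ring

/-- Test with the negative part v: by `inner_posPart` for -u, `⟨u, v⟩ ≤ -‖v‖²`, which forces v = 0.
-/
theorem ae_nonneg_of_inner_nonneg {u : HomSobolev N s}
    (h : ∀ φ : HomSobolev N s, (∀ᵐ x, φ x = max (-u x) 0) → 0 ≤ inner ℝ u φ) :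
    ∀ᵐ x, 0 ≤ u x := by
  obtain ⟨v, hv⟩ := exists_posPart (-u)
  have hneg : ∀ᵐ x, (-u) x = -u x := Lp.coeFn_neg (toLp u)
  have hv' : ∀ᵐ x, v x = max (-u x) 0 := by
    filter_upwards [hv, hneg] with x h1 h2
    rw [h1, h2]
  have h1 := inner_posPart hv
  have h2 : 0 ≤ ∫ z, crossIntegrand s (-u : HomSobolev N s) z :=
    integral_nonneg (crossIntegrand_nonneg _)
  have h3 := h v hv'
  rw [inner_neg_left] at h1
  have h4 : ‖v‖ ^ 2 = 0 := le_antisymm (by linarith) (sq_nonneg _)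
  have h5 : v = 0 := by simpa using h4
  have h6 : ∀ᵐ x, v x = 0 := by rw [h5]; exact Lp.coeFn_zero _ _ _
  filter_upwards [hv', h6] with x h7 h8
  have := le_max_left (-u x) 0
  linarith

/-! ### The strong maximum principle. -/

/-- Nonlocal interaction between the zero set of a supersolution and its complement. -/
theorem ae_mul_eq_zero_of_supersolution {u η : HomSobolev N s} (hu0 : ∀ᵐ x, 0 ≤ u x)
    (hu : ∀ φ : HomSobolev N s, (∀ᵐ x, 0 ≤ φ x) → 0 ≤ inner ℝ u φ) (hη : ∀ᵐ x, 0 ≤ η x) :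
    ∀ᵐ z : EuclideanSpace ℝ (Fin N) × EuclideanSpace ℝ (Fin N)
      ∂((volume : Measure (EuclideanSpace ℝ (Fin N))).prod volume),
      u z.2 = 0 → u z.1 * η z.2 = 0 := by
  -- Test the supersolution with v = (εη - u)_+. The cross term is at most `ε ‖η‖ ‖v‖ - ‖v‖²`, hence
  -- of order ε².
  have hcross : ∀ ε > 0, Integrable (crossIntegrand s (ε • η - u : HomSobolev N s)) ∧
      ∫ z, crossIntegrand s (ε • η - u : HomSobolev N s) z ≤ ε ^ 2 * ‖η‖ ^ 2 := by
    intro ε hε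
    obtain ⟨v, hv⟩ := exists_posPart (ε • η - u)
    refine ⟨integrable_crossIntegrand hv, ?_⟩
    have h1 := inner_posPart hv
    rw [inner_sub_left, real_inner_smul_left] at h1
    have h2 : 0 ≤ inner ℝ u v := hu v (by
      filter_upwards [hv] with x hx
      rw [hx]; exact le_max_right _ _)
    have h3 : ε * inner ℝ η v ≤ ε * (‖η‖ * ‖v‖) := by
      gcongr; exact real_inner_le_norm η v
    nlinarith [sq_nonneg (ε * ‖η‖ - ‖v‖), sq_nonneg (ε * ‖η‖), sq_nonneg ‖v‖]
  have hfst := Measure.quasiMeasurePreserving_fst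
    (μ := (volume : Measure (EuclideanSpace ℝ (Fin N))))
    (ν := (volume : Measure (EuclideanSpace ℝ (Fin N))))
  have hsnd := Measure.quasiMeasurePreserving_snd
    (μ := (volume : Measure (EuclideanSpace ℝ (Fin N))))
    (ν := (volume : Measure (EuclideanSpace ℝ (Fin N))))
  have hcomb : ∀ ε : ℝ, ∀ᵐ x, (ε • η - u : HomSobolev N s) x = ε * η x - u x := by
    intro ε
    filter_upwards [coeFn_sub (ε • η) u, coeFn_smul ε η] with x h1 h2
    simp [h1, h2]
  -- Independent of ε: it is to be dominated by the cross term divided by ε, for every ε ≤ δ.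
  set Φ : ℝ → EuclideanSpace ℝ (Fin N) × EuclideanSpace ℝ (Fin N) → ℝ := fun δ z =>
    max (u z.1 - δ * η z.1) 0 * ({y | u y = 0}.indicator η z.2) /
      ‖z.1 - z.2‖ ^ ((N : ℝ) + 2 * s) with hΦ
  have hΦ0 : ∀ δ, 0 ≤ᵐ[(volume : Measure (EuclideanSpace ℝ (Fin N))).prod volume] Φ δ := by
    intro δ
    filter_upwards [hsnd.ae hη] with z hz
    have : 0 ≤ {y | u y = 0}.indicator η z.2 := Set.indicator_apply_nonneg fun _ => hz
    simp only [Pi.zero_apply, hΦ]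
    positivity
  -- On the zero set of u, (εη - u)_+ equals εη, only first order in ε. After division by ε the
  -- bound on the integral is `ε ‖η‖²`, which tends to 0.
  have hΦle : ∀ δ ε, 0 < ε → ε ≤ δ →
      ∀ᵐ z ∂((volume : Measure (EuclideanSpace ℝ (Fin N))).prod volume),
        Φ δ z ≤ ε⁻¹ * crossIntegrand s (ε • η - u : HomSobolev N s) z := by
    intro δ ε hε hεδ
    filter_upwards [hfst.ae (hcomb ε), hsnd.ae (hcomb ε), hfst.ae hη, hsnd.ae hη]
      with z h1 h2 h3 h4
    simp only [hΦ, crossIntegrand, h1, h2]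
    rw [mul_div_assoc']
    refine div_le_div_of_nonneg_right ?_ (by positivity)
    have h5 : max (u z.1 - δ * η z.1) 0 ≤ max (-(ε * η z.1 - u z.1)) 0 := by
      apply max_le_max_right
      nlinarith
    have h6 : {y | u y = 0}.indicator η z.2 ≤ ε⁻¹ * max (ε * η z.2 - u z.2) 0 := by
      by_cases h7 : u z.2 = 0
      · rw [Set.indicator_of_mem (by exact h7), h7, sub_zero, max_eq_left (by positivity),
          inv_mul_cancel_left₀ hε.ne']
      · rw [Set.indicator_of_notMem (by exact h7)]
        positivity
    have h8 : 0 ≤ {y | u y = 0}.indicator η z.2 := Set.indicator_apply_nonneg fun _ => h4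
    have h9 : 0 ≤ max (ε * η z.1 - u z.1) 0 * max (-(ε * η z.2 - u z.2)) 0 := by positivity
    calc _ ≤ max (-(ε * η z.1 - u z.1)) 0 * (ε⁻¹ * max (ε * η z.2 - u z.2) 0) := by
          gcongr
      _ = ε⁻¹ * (max (-(ε * η z.1 - u z.1)) 0 * max (ε * η z.2 - u z.2) 0) := by ring
      _ ≤ _ := by gcongr; linarith
  have hum : Measurable (u : EuclideanSpace ℝ (Fin N) → ℝ) :=
    (Lp.stronglyMeasurable (toLp u)).measurable
  have hηm : Measurable (η : EuclideanSpace ℝ (Fin N) → ℝ) :=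
    (Lp.stronglyMeasurable (toLp η)).measurable
  have hZ : MeasurableSet {y | u y = 0} := hum (measurableSet_singleton 0)
  have hΦm : ∀ δ, Measurable (Φ δ) := by
    intro δ
    have h1 : Measurable ({y | u y = 0}.indicator η) := hηm.indicator hZ
    simp only [hΦ]
    fun_prop
  have hΦi : ∀ δ > 0, Integrable (Φ δ)
      ((volume : Measure (EuclideanSpace ℝ (Fin N))).prod volume) := by
    intro δ hδ
    refine ((hcross δ hδ).1.const_mul δ⁻¹).mono' (hΦm δ).aestronglyMeasurable ?_
    filter_upwards [hΦ0 δ, hΦle δ δ hδ le_rfl] with z h1 h2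
    rwa [Real.norm_of_nonneg h1]
  have hΦz : ∀ δ > 0, Φ δ =ᵐ[(volume : Measure (EuclideanSpace ℝ (Fin N))).prod volume] 0 := by
    intro δ hδ
    rw [← integral_eq_zero_iff_of_nonneg_ae (hΦ0 δ) (hΦi δ hδ)]
    refine le_antisymm ?_ (integral_nonneg_of_ae (hΦ0 δ))
    have h1 : ∀ ε, 0 < ε → ε ≤ δ → ∫ z, Φ δ z
        ∂((volume : Measure (EuclideanSpace ℝ (Fin N))).prod volume) ≤ ε * ‖η‖ ^ 2 := by
      intro ε hε hεδ
      calc _ ≤ ∫ z, ε⁻¹ * crossIntegrand s (ε • η - u : HomSobolev N s) z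
            ∂((volume : Measure (EuclideanSpace ℝ (Fin N))).prod volume) :=
            integral_mono_ae (hΦi δ hδ) ((hcross ε hε).1.const_mul _) (hΦle δ ε hε hεδ)
        _ = ε⁻¹ * ∫ z, crossIntegrand s (ε • η - u : HomSobolev N s) z :=
            integral_const_mul _ _
        _ ≤ ε⁻¹ * (ε ^ 2 * ‖η‖ ^ 2) := by gcongr; exact (hcross ε hε).2
        _ = _ := by field_simp
    have h2 : Filter.Tendsto (fun ε : ℝ => ε * ‖η‖ ^ 2) (nhdsWithin 0 (Set.Ioi 0)) (nhds 0) := by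
      have : Filter.Tendsto (fun ε : ℝ => ε * ‖η‖ ^ 2) (nhds 0) (nhds (0 * ‖η‖ ^ 2)) :=
        (continuous_id.mul continuous_const).tendsto 0
      rw [zero_mul] at this
      exact this.mono_left nhdsWithin_le_nhds
    refine ge_of_tendsto h2 ?_
    filter_upwards [Ioc_mem_nhdsGT hδ] with ε hε using h1 ε hε.1 hε.2
  have hall : ∀ᵐ z ∂((volume : Measure (EuclideanSpace ℝ (Fin N))).prod volume),
      ∀ n : ℕ, Φ (1 / ((n : ℝ) + 1)) z = 0 :=
    ae_all_iff.2 fun n => hΦz _ (by positivity)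
  filter_upwards [hall, hfst.ae hu0] with z h1 h2 h3
  -- On the diagonal division by zero makes Φ uninformative, but there both values of u vanish.
  by_cases hz : z.1 = z.2
  · rw [hz, h3, zero_mul]
  by_cases h4 : η z.2 = 0
  · rw [h4, mul_zero]
  have hk : ‖z.1 - z.2‖ ^ ((N : ℝ) + 2 * s) ≠ 0 :=
    (Real.rpow_pos_of_pos (norm_pos_iff.2 (sub_ne_zero.2 hz)) _).ne'
  have h5 : ∀ n : ℕ, u z.1 ≤ 1 / ((n : ℝ) + 1) * η z.1 := by
    intro n
    have h6 := h1 n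
    simp only [hΦ, div_eq_zero_iff, hk, or_false, mul_eq_zero] at h6
    rw [Set.indicator_of_mem (by exact h3)] at h6
    have h7 := h6.resolve_right h4
    have := le_max_left (u z.1 - 1 / ((n : ℝ) + 1) * η z.1) 0
    linarith
  have h6 : Filter.Tendsto (fun n : ℕ => 1 / ((n : ℝ) + 1) * η z.1) Filter.atTop
      (nhds (0 * η z.1)) := tendsto_one_div_add_atTop_nhds_zero_nat.mul_const _
  rw [zero_mul] at h6
  have h7 : u z.1 ≤ 0 := ge_of_tendsto' h6 h5
  rw [le_antisymm h7 h2, zero_mul]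

omit hs hN in
theorem exists_translate (u : HomSobolev N s) (h : EuclideanSpace ℝ (Fin N)) :
    ∃ v : HomSobolev N s, ∀ᵐ x, v x = u (x + h) := by
  have h1 : MemLp (fun x => u (x + h)) (ENNReal.ofReal (critExp N s)) volume :=
    u.memLp.comp_measurePreserving (measurePreserving_add_right volume h)
  have h2 : Integrable (gagliardoIntegrand s (fun x => u (x + h)) (fun x => u (x + h)))
      volume := by
    have h3 := Integrable.comp_add_right
      (μ := (volume : Measure (EuclideanSpace ℝ (Fin N))).prod volume) u.integrable_self (h, h)
    refine h3.congr (Filter.Eventually.of_forall fun z => ?_)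
    simp [gagliardoIntegrand]
  exact ⟨mk _ h1 h2, coeFn_mk h1 h2⟩

/-- The strong maximum principle for supersolutions of the fractional Laplacian. -/
theorem ae_pos_of_supersolution {u : HomSobolev N s} (hu0 : ∀ᵐ x, 0 ≤ u x)
    (hu : ∀ φ : HomSobolev N s, (∀ᵐ x, 0 ≤ φ x) → 0 ≤ inner ℝ u φ) (hne : u ≠ 0) :
    ∀ᵐ x, 0 < u x := by
  have hum : Measurable (u : EuclideanSpace ℝ (Fin N) → ℝ) :=
    (Lp.stronglyMeasurable (toLp u)).measurable
  have hnz : ¬ ∀ᵐ x, u x = 0 := fun h =>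
    hne (Subtype.ext ((Lp.eq_zero_iff_ae_eq_zero (f := toLp u)).2 h))
  -- Taking η to be a translate of u shows that the zero set is carried into itself, up to null
  -- sets, by every translation.
  have h1 : ∀ h : EuclideanSpace ℝ (Fin N), ∀ᵐ y, u y = 0 → u (y + h) = 0 := by
    intro h
    obtain ⟨η, hη⟩ := exists_translate u h
    have hη0 : ∀ᵐ x, 0 ≤ η x := by
      filter_upwards [hη, (measurePreserving_add_right volume h).quasiMeasurePreserving.ae hu0]
        with x h2 h3
      rwa [h2]
    have h4 := Measure.ae_ae_of_ae_prod (ae_mul_eq_zero_of_supersolution hu0 hu hη0)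
    obtain ⟨x, hx, h5⟩ : ∃ x, u x ≠ 0 ∧ ∀ᵐ y, u y = 0 → u x * η y = 0 := by
      by_contra hcon
      refine hnz ?_
      filter_upwards [h4] with x hx
      by_contra hux
      exact hcon ⟨x, hux, hx⟩
    filter_upwards [h5, hη] with y h6 h7 h8
    rw [← h7]
    exact (mul_eq_zero.1 (h6 h8)).resolve_left hx
  have hmeas : MeasurableSet {z : EuclideanSpace ℝ (Fin N) × EuclideanSpace ℝ (Fin N) |
      u z.2 = 0 → u (z.2 + z.1) = 0} := by
    have h2 : MeasurableSet {z : EuclideanSpace ℝ (Fin N) × EuclideanSpace ℝ (Fin N) |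
        u z.2 = 0} := (hum.comp measurable_snd) (measurableSet_singleton 0)
    have h3 : MeasurableSet {z : EuclideanSpace ℝ (Fin N) × EuclideanSpace ℝ (Fin N) |
        u (z.2 + z.1) = 0} :=
      (hum.comp (measurable_snd.add measurable_fst)) (measurableSet_singleton 0)
    exact h2.imp h3
  -- Exchanging y and h by Fubini: for almost every y, if u vanishes at y then it vanishes at almost
  -- every translate, that is, almost everywhere.
  have h2 := (Measure.ae_ae_comm (μ := volume) (ν := volume) hmeas).1
    (Filter.Eventually.of_forall h1)
  filter_upwards [hu0, h2] with y h3 h4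
  refine h3.lt_of_ne fun h5 => hnz ?_
  have h6 : ∀ᵐ h, u (y + h) = 0 := by
    filter_upwards [h4] with h h7 using h7 h5.symm
  have h7 := (measurePreserving_add_left volume (-y)).quasiMeasurePreserving.ae h6
  filter_upwards [h7] with x hx
  simpa using hx

/-! ### Negative energy and removal of the truncation. -/

/-- For a small multiple of a vector where f is positive, the linear term beats the quadratic one,
and the nonlinear term only lowers the energy. -/
theorem exists_truncatedEnergy_neg (ha0 : ∀ᵐ x, 0 ≤ a x) {f : StrongDual ℝ (HomSobolev N s)}
    (hf : f ≠ 0) {r : ℝ} (hr : 0 < r) :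
    ∃ v ∈ Metric.ball (0 : HomSobolev N s) r, truncatedEnergy a f v < 0 := by
  obtain ⟨v, hv⟩ : ∃ v, 0 < f v := by
    by_contra! hcon
    refine hf (ContinuousLinearMap.ext fun v => le_antisymm (hcon v) ?_)
    have := hcon (-v)
    simpa using this
  have hv0 : 0 < ‖v‖ := norm_pos_iff.2 fun h => by simp [h] at hv
  set t := min (r / (2 * ‖v‖)) (f v / ‖v‖ ^ 2) with ht
  have ht0 : 0 < t := lt_min (by positivity) (by positivity)
  have h1 : t * (2 * ‖v‖) ≤ r := by
    rw [← le_div_iff₀ (by positivity)]; exact min_le_left _ _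
  have h2 : t * ‖v‖ ^ 2 ≤ f v := by
    rw [← le_div_iff₀ (by positivity)]; exact min_le_right _ _
  have hn : ‖t • v‖ = t * ‖v‖ := by rw [norm_smul, Real.norm_of_nonneg ht0.le]
  refine ⟨t • v, ?_, ?_⟩
  · rw [mem_ball_zero_iff, hn]
    nlinarith
  · have h3 := integral_weight_max_rpow_nonneg ha0 (t • v)
    have h4 : 0 ≤ 1 / critExp N s * ∫ x, a x * max ((t • v) x) 0 ^ critExp N s :=
      mul_nonneg (one_div_pos.2 critExp_pos).le h3
    simp only [truncatedEnergy, map_smul, smul_eq_mul, hn]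
    have h5 : t * (t * ‖v‖ ^ 2) ≤ t * f v := by gcongr
    have h6 : 0 < t * f v := by positivity
    linarith

theorem truncatedEnergy_zero (f : StrongDual ℝ (HomSobolev N s)) :
    truncatedEnergy a f (0 : HomSobolev N s) = 0 := by
  have h0 : ∀ᵐ x, (0 : HomSobolev N s) x = 0 := Lp.coeFn_zero _ _ _
  have h1 : ∫ x, a x * max ((0 : HomSobolev N s) x) 0 ^ critExp N s = 0 := by
    rw [integral_congr_ae (g := fun _ => 0), integral_zero]
    filter_upwards [h0] with x hx
    simp [hx, Real.zero_rpow (critExp_pos (N := N) (s := s)).ne']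
  simp [truncatedEnergy, h1]

theorem energy_eq_truncatedEnergy (f : StrongDual ℝ (HomSobolev N s)) {u : HomSobolev N s}
    (hu : ∀ᵐ x, 0 ≤ u x) : energy a f u = truncatedEnergy a f u := by
  unfold energy truncatedEnergy
  congr 3
  refine integral_congr_ae ?_
  filter_upwards [hu] with x hx
  simp only [abs_of_nonneg hx, max_eq_left hx]

end HomSobolev

end

/-! ### The main theorem. -/

theorem theorem1p1 (N : ℕ) (s : ℝ) [Fact (0 < s)] [Fact (2 * s < N)] (hs1 : s < 1)
    (a : EuclideanSpace ℝ (Fin N) → ℝ) (ha : MemLp a ⊤ volume) (ha_pos : ∀ᵐ x, 0 < a x) :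
    ∃ d : ℝ, 0 < d ∧ ∃ r : ℝ, 0 < r ∧
      ∀ f : StrongDual ℝ (HomSobolev N s), IsNonnegNontrivial f → ‖f‖ ≤ d →
        StrictConvexOn ℝ (Metric.ball (0 : HomSobolev N s) r) (truncatedEnergy a f) ∧
        ∃ u : HomSobolev N s, IsPositiveWeakSolution a f u ∧ energy a f u < 0 ∧
          u ∈ Metric.ball (0 : HomSobolev N s) r ∧
          IsMinOn (truncatedEnergy a f) (Metric.ball (0 : HomSobolev N s) r) u := by
  obtain ⟨S, hS0, hS⟩ := HomSobolev.exists_integral_rpow_le N s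
  have ham := ha.aestronglyMeasurable
  have ha0 : ∀ᵐ x, 0 ≤ a x := ha_pos.mono fun x hx => hx.le
  obtain ⟨A, hA0, hA⟩ : ∃ A : ℝ, 0 < A ∧ ∀ᵐ x, |a x| ≤ A := by
    refine ⟨(eLpNormEssSup a volume).toReal + 1, by positivity, ?_⟩
    have hlt : eLpNormEssSup a volume < ⊤ := by simpa using ha.eLpNorm_lt_top
    filter_upwards [ae_le_eLpNormEssSup (f := a) (μ := volume)] with x hx
    have h1 := ENNReal.toReal_mono hlt.ne hx
    simp only [toReal_enorm, Real.norm_eq_abs] at h1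
    linarith
  obtain ⟨r, hr0, hconv, hsmall⟩ := HomSobolev.exists_strongConvexOn ham hA hA0 ha0 hS0 hS
  -- With this bound on f the energy on the sphere of radius r is at least `r²/4 - r²/8 > 0`, so the
  -- minimiser over the closed ball, having negative energy, is interior.
  refine ⟨r / 8, by positivity, r, hr0, fun f hf hfd => ?_⟩
  have hlower : ∀ v : HomSobolev N s, ‖v‖ ≤ r →
      1 / 4 * ‖v‖ ^ 2 - r / 8 * ‖v‖ ≤ truncatedEnergy a f v := by
    intro v hv
    have h1 := hsmall v hv
    have h2 : f v ≤ r / 8 * ‖v‖ :=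
      (le_abs_self _).trans ((f.le_opNorm v).trans (by gcongr))
    unfold truncatedEnergy
    linarith
  have hbdd : BddBelow (truncatedEnergy a f '' Metric.closedBall (0 : HomSobolev N s) r) := by
    refine ⟨-(r / 8 * r), ?_⟩
    rintro _ ⟨v, hv, rfl⟩
    rw [mem_closedBall_zero_iff] at hv
    have h1 := hlower v hv
    have h2 : r / 8 * ‖v‖ ≤ r / 8 * r := by gcongr
    nlinarith [sq_nonneg ‖v‖]
  obtain ⟨u, huK, humin⟩ := (hconv f).exists_isMinOn (by norm_num) Metric.isClosed_closedBall
    ⟨0, Metric.mem_closedBall_self hr0.le⟩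
    (HomSobolev.continuousOn_truncatedEnergy ham hA hA0 ha0 hS f hr0) hbdd
  obtain ⟨v, hv, hvneg⟩ := HomSobolev.exists_truncatedEnergy_neg ha0 hf.1 hr0
  have hneg : truncatedEnergy a f u < 0 :=
    (humin (Metric.ball_subset_closedBall hv)).trans_lt hvneg
  have hub : u ∈ Metric.ball (0 : HomSobolev N s) r := by
    rw [mem_closedBall_zero_iff] at huK
    rw [mem_ball_zero_iff]
    have h1 := hlower u huK
    nlinarith [norm_nonneg u]
  have hmin : IsMinOn (truncatedEnergy a f) (Metric.ball (0 : HomSobolev N s) r) u :=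
    humin.on_subset Metric.ball_subset_closedBall
  have hEL := HomSobolev.euler_lagrange ham hA ha0 hub hmin
  have hu0 : ∀ᵐ x, 0 ≤ u x := by
    refine HomSobolev.ae_nonneg_of_inner_nonneg fun φ hφ => ?_
    have hφ0 : ∀ᵐ x, 0 ≤ φ x := by
      filter_upwards [hφ] with x hx
      rw [hx]; exact le_max_right _ _
    rw [hEL φ]
    refine add_nonneg (integral_nonneg_of_ae ?_) (hf.2 φ hφ0)
    filter_upwards [ha0, hφ0] with x h1 h2
    simp only [Pi.zero_apply]
    positivity
  have hsuper : ∀ φ : HomSobolev N s, (∀ᵐ x, 0 ≤ φ x) → 0 ≤ inner ℝ u φ := by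
    intro φ hφ0
    rw [hEL φ]
    refine add_nonneg (integral_nonneg_of_ae ?_) (hf.2 φ hφ0)
    filter_upwards [ha0, hφ0] with x h1 h2
    simp only [Pi.zero_apply]
    positivity
  have hne : u ≠ 0 := by
    rintro rfl
    rw [HomSobolev.truncatedEnergy_zero] at hneg
    exact hneg.false
  refine ⟨(hconv f).strictConvexOn (by norm_num) |>.subset Metric.ball_subset_closedBall
    (convex_ball _ _), u, ⟨HomSobolev.ae_pos_of_supersolution hu0 hsuper hne, fun φ => ?_⟩, ?_, hub, hmin⟩
  · rw [← HomSobolev.inner_eq, hEL φ]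
    congr 1
    refine integral_congr_ae ?_
    filter_upwards [hu0] with x hx
    simp only [max_eq_left hx]
    ring
  · rwa [HomSobolev.energy_eq_truncatedEnergy f hu0]
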